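/- Let $n\ge 1$, let $m$ be Lebesgue measure on $\mathbb C^n=\mathbb R^{2n}$, and for $\lambda\in\mathbb R$ and $z=x+iy\in\mathbb C^n$ let $\pi_\lambda(z)$ be the unitary operator on $L^2(\mathbb R^n)$ given by $$(\pi_\lambda(z)\varphi)(\xi)=e^{i\lambda\left(x\cdot\xi+\frac12 x\cdot y\right)}\varphi(\xi+y).$$ For $g\in L^1(\mathbb C^n)$ let $W_\lambda(g)=\int_{\mathbb C^n}g(w)\,\pi_\lambda(w)\,dw$ be its Weyl transform, a bounded operator on $L^2(\mathbb R^n)$ (the integral is taken in the strong sense). For $g\in L^2(\mathbb C^n)$ let $W(g)$ be the bounded operator on $L^2(\mathbb R^n)$ determined by $\langle W(g)\varphi,\psi\rangle=\int_{\mathbb C^n}g(z)\langle\pi_1(z)\varphi,\psi\rangle\,dz$ for all $\varphi,\psi\in L^2(\mathbb R^n)$. Let $A\subseteq\mathbb C^n$ be a Lebesgue measurable set with $m(A)<\infty$. (1) Let $\lambda\in\mathbb R\setminus\{0\}$ and $g\in L^1(\mathbb C^n)$. If $g=0$ almost everywhere outside $A$ and $W_\lambda(g)$ has finite rank, then $g=0$.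 (2) Let $B$ be a finite-dimensional subspace of $L^2(\mathbb R^n)$. Let $E_A$ be the orthogonal projection $g\mapsto\chi_A g$ of $L^2(\mathbb C^n)$, and let $F_B$ be the orthogonal projection of $L^2(\mathbb C^n)$ onto the closed subspace of all $g$ for which the range of $W(g)$ is contained in $B$ (equivalently, $W(F_Bg)=P_BW(g)$ for all $g$, where $P_B$ is the orthogonal projection of $L^2(\mathbb R^n)$ onto $B$). Then $E_A\cap F_B=0$, where $E_A\cap F_B$ denotes the orthogonal projection onto the intersection of the ranges of $E_A$ and $F_B$. -/

import Mathlib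

open MeasureTheory

namespace HeisenbergWeyl

noncomputable section

/-! ### The underlying Hilbert spaces -/

/-- `L²(ℝⁿ)`. -/
abbrev L2R (n : ℕ) : Type := Lp ℂ 2 (volume : Measure (EuclideanSpace ℝ (Fin n)))

/-- `L²(ℂⁿ)`, with respect to Lebesgue measure `dx dy`, `z = x + i y`. -/
abbrev L2C (n : ℕ) : Type := Lp ℂ 2 (volume : Measure (Fin n → ℂ))

/-- `L¹(ℂⁿ)`. -/
abbrev L1C (n : ℕ) : Type := Lp ℂ 1 (volume : Measure (Fin n → ℂ))

/-- The real part `x` of `z = x + i y ∈ ℂⁿ`. -/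
def rePart {n : ℕ} (z : Fin n → ℂ) : EuclideanSpace ℝ (Fin n) := WithLp.toLp 2 fun j => (z j).re

/-- The imaginary part `y` of `z = x + i y ∈ ℂⁿ`. -/
def imPart {n : ℕ} (z : Fin n → ℂ) : EuclideanSpace ℝ (Fin n) := WithLp.toLp 2 fun j => (z j).im

theorem continuous_rePart {n : ℕ} : Continuous (rePart (n := n)) := by
  unfold rePart; fun_prop

theorem continuous_imPart {n : ℕ} : Continuous (imPart (n := n)) := by
  unfold imPart; fun_prop

/-! ### The Schrödinger representation -/

/-- The phase `exp (i λ (x · ξ + x · y / 2))`, where `z = x + i y`. -/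
def phase {n : ℕ} (lam : ℝ) (z : Fin n → ℂ) (ξ : EuclideanSpace ℝ (Fin n)) : ℂ :=
  Complex.exp (Complex.I *
    ((lam * (inner ℝ (rePart z) ξ + (1 / 2) * inner ℝ (rePart z) (imPart z)) : ℝ) : ℂ))

theorem norm_phase {n : ℕ} (lam : ℝ) (z : Fin n → ℂ) (ξ : EuclideanSpace ℝ (Fin n)) :
    ‖phase lam z ξ‖ = 1 := by
  rw [phase, mul_comm]; exact Complex.norm_exp_ofReal_mul_I _

theorem continuous_phase {n : ℕ} (lam : ℝ) (z : Fin n → ℂ) : Continuous (phase lam z) := by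
  unfold phase; fun_prop

theorem continuous_phase_left {n : ℕ} (lam : ℝ) (ξ : EuclideanSpace ℝ (Fin n)) :
    Continuous fun z => phase lam z ξ := by
  have h1 := continuous_rePart (n := n)
  have h2 := continuous_imPart (n := n)
  unfold phase; fun_prop

theorem memLp_phase_mul {n : ℕ} (lam : ℝ) (z : Fin n → ℂ) (φ : L2R n) :
    MemLp (fun ξ => phase lam z ξ * φ ξ) 2 volume := by
  refine (Lp.memLp φ).congr_norm
    ((continuous_phase lam z).aestronglyMeasurable.mul (Lp.aestronglyMeasurable φ)) ?_
  filter_upwards with ξ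
  rw [norm_mul, norm_phase, one_mul]

/-- Multiplication by the phase, an isometry of `L²(ℝⁿ)`. -/
def modulation {n : ℕ} (lam : ℝ) (z : Fin n → ℂ) : L2R n →ₗᵢ[ℂ] L2R n where
  toFun φ := (memLp_phase_mul lam z φ).toLp _
  map_add' φ ψ := by
    ext1
    filter_upwards [(memLp_phase_mul lam z (φ + ψ)).coeFn_toLp,
      (memLp_phase_mul lam z φ).coeFn_toLp, (memLp_phase_mul lam z ψ).coeFn_toLp,
      Lp.coeFn_add φ ψ, Lp.coeFn_add ((memLp_phase_mul lam z φ).toLp _)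
        ((memLp_phase_mul lam z ψ).toLp _)] with ξ h1 h2 h3 h4 h5
    rw [h1, h5, Pi.add_apply, h2, h3, h4, Pi.add_apply, mul_add]
  map_smul' c φ := by
    ext1
    filter_upwards [(memLp_phase_mul lam z (c • φ)).coeFn_toLp,
      (memLp_phase_mul lam z φ).coeFn_toLp,
      Lp.coeFn_smul c φ, Lp.coeFn_smul c ((memLp_phase_mul lam z φ).toLp _)] with ξ h1 h2 h4 h5
    rw [RingHom.id_apply, h1, h5, Pi.smul_apply, h2, h4, Pi.smul_apply, smul_eq_mul, smul_eq_mul]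
    ring
  norm_map' φ := by
    change ‖(memLp_phase_mul lam z φ).toLp _‖ = ‖φ‖
    refine le_antisymm (Lp.norm_le_norm_of_ae_le ?_) (Lp.norm_le_norm_of_ae_le ?_) <;>
    filter_upwards [(memLp_phase_mul lam z φ).coeFn_toLp] with ξ h <;>
    rw [h, norm_mul, norm_phase, one_mul]

theorem coeFn_modulation {n : ℕ} (lam : ℝ) (z : Fin n → ℂ) (φ : L2R n) :
    modulation lam z φ =ᵐ[volume] fun ξ => phase lam z ξ * φ ξ :=
  (memLp_phase_mul lam z φ).coeFn_toLp

/-- The translation `φ ↦ φ(· + y)`, an isometry of `L²(ℝⁿ)`. -/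
def translation {n : ℕ} (y : EuclideanSpace ℝ (Fin n)) : L2R n →ₗᵢ[ℂ] L2R n :=
  Lp.compMeasurePreservingₗᵢ ℂ (fun ξ => ξ + y) (measurePreserving_add_right volume y)

theorem coeFn_translation {n : ℕ} (y : EuclideanSpace ℝ (Fin n)) (φ : L2R n) :
    translation y φ =ᵐ[volume] fun ξ => φ (ξ + y) :=
  Lp.coeFn_compMeasurePreserving φ (measurePreserving_add_right volume y)

/-- The Schrödinger representation `π_λ(z) = π_λ(z, 0)` on `L²(ℝⁿ)`:
`(π_λ(z) φ)(ξ) = exp (i λ (x · ξ + x · y / 2)) φ(ξ + y)` for `z = x + i y`. -/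
def schrodinger {n : ℕ} (lam : ℝ) (z : Fin n → ℂ) : L2R n →ₗᵢ[ℂ] L2R n :=
  (modulation lam z).comp (translation (imPart z))

theorem coeFn_schrodinger {n : ℕ} (lam : ℝ) (z : Fin n → ℂ) (φ : L2R n) :
    schrodinger lam z φ =ᵐ[volume] fun ξ =>
      Complex.exp (Complex.I *
        ((lam * (inner ℝ (rePart z) ξ + (1 / 2) * inner ℝ (rePart z) (imPart z)) : ℝ) : ℂ)) *
        φ (ξ + imPart z) := by
  filter_upwards [coeFn_modulation lam z (translation (imPart z) φ),
    coeFn_translation (imPart z) φ] with ξ h1 h2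
  change modulation lam z (translation (imPart z) φ) ξ = _
  rw [h1, h2, phase]

theorem continuous_translation {n : ℕ} (φ : L2R n) :
    Continuous fun z : Fin n → ℂ => translation (imPart z) φ := by
  have hF : Continuous fun z : Fin n → ℂ =>
      (⟨fun ξ => ξ + imPart z, by fun_prop⟩ :
        C(EuclideanSpace ℝ (Fin n), EuclideanSpace ℝ (Fin n))) := by
    refine ContinuousMap.continuous_of_continuous_uncurry _ ?_
    have h2 := continuous_imPart (n := n)
    change Continuous fun p : (Fin n → ℂ) × EuclideanSpace ℝ (Fin n) => p.2 + imPart p.1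
    fun_prop
  exact (continuous_const (y := φ)).compMeasurePreservingLp hF
    (fun z => measurePreserving_add_right volume (imPart z)) (by norm_num)

theorem continuous_modulation {n : ℕ} (lam : ℝ) (φ : L2R n) :
    Continuous fun z : Fin n → ℂ => modulation lam z φ := by
  rw [continuous_iff_continuousAt]
  intro z₀
  rw [ContinuousAt, Lp.tendsto_Lp_iff_tendsto_eLpNorm']
  have key : ∀ z, eLpNorm (⇑(modulation lam z φ) - ⇑(modulation lam z₀ φ)) 2 volume
      = (∫⁻ ξ, ‖phase lam z ξ - phase lam z₀ ξ‖ₑ ^ (2 : ℝ) * ‖φ ξ‖ₑ ^ (2 : ℝ)) ^ (1 / (2 : ℝ)) := by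
    intro z
    rw [eLpNorm_eq_lintegral_rpow_enorm_toReal (by norm_num) (by norm_num)]
    simp only [ENNReal.toReal_ofNat]
    congr 1
    refine lintegral_congr_ae ?_
    filter_upwards [coeFn_modulation lam z φ, coeFn_modulation lam z₀ φ] with ξ h1 h2
    rw [Pi.sub_apply, h1, h2, ← sub_mul, enorm_mul, ENNReal.mul_rpow_of_nonneg _ _ (by norm_num)]
  simp_rw [key]
  have h0 : (0 : ENNReal) = (∫⁻ ξ : EuclideanSpace ℝ (Fin n), 0) ^ (1 / (2 : ℝ)) := by simp
  rw [h0]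
  refine (ENNReal.continuous_rpow_const.tendsto _).comp ?_
  refine tendsto_lintegral_filter_of_dominated_convergence
    (fun ξ => (2 : ENNReal) ^ (2 : ℝ) * ‖φ ξ‖ₑ ^ (2 : ℝ)) ?_ ?_ ?_ ?_
  · refine Filter.Eventually.of_forall fun z => ?_
    have h1 := (continuous_phase lam z).measurable
    have h2 := (continuous_phase lam z₀).measurable
    have h3 := (Lp.stronglyMeasurable φ).measurable
    fun_prop
  · refine Filter.Eventually.of_forall fun z => Filter.Eventually.of_forall fun ξ => ?_
    gcongr
    refine (enorm_sub_le).trans ?_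
    rw [← ofReal_norm, ← ofReal_norm, norm_phase, norm_phase]
    norm_num
  · have h := (Lp.memLp φ).2
    rw [eLpNorm_lt_top_iff_lintegral_rpow_enorm_lt_top (by norm_num) (by norm_num)] at h
    simp only [ENNReal.toReal_ofNat] at h
    rw [lintegral_const_mul' _ _ (by norm_num)]
    exact (ENNReal.mul_lt_top (by norm_num) h).ne
  · refine Filter.Eventually.of_forall fun ξ => ?_
    have hc : Continuous fun z => ‖phase lam z ξ - phase lam z₀ ξ‖ₑ ^ (2 : ℝ) :=
      ENNReal.continuous_rpow_const.comp
        (((continuous_phase_left lam ξ).sub continuous_const).enorm)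
    have ht := hc.tendsto z₀
    have hz : ‖phase lam z₀ ξ - phase lam z₀ ξ‖ₑ ^ (2 : ℝ) = 0 := by simp
    rw [hz] at ht
    have := ENNReal.Tendsto.mul_const (b := ‖φ ξ‖ₑ ^ (2 : ℝ)) ht (Or.inr (by simp))
    simpa using this

/-- Strong continuity of the Schrödinger representation. -/
theorem continuous_schrodinger {n : ℕ} (lam : ℝ) (φ : L2R n) :
    Continuous fun z : Fin n → ℂ => schrodinger lam z φ := by
  rw [continuous_iff_continuousAt]
  intro z₀
  rw [ContinuousAt, tendsto_iff_norm_sub_tendsto_zero]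
  have h1 : Filter.Tendsto (fun z => ‖translation (imPart z) φ - translation (imPart z₀) φ‖
      + ‖modulation lam z (translation (imPart z₀) φ)
        - modulation lam z₀ (translation (imPart z₀) φ)‖) (nhds z₀) (nhds (0 + 0)) :=
    (tendsto_iff_norm_sub_tendsto_zero.1 ((continuous_translation φ).tendsto z₀)).add
      (tendsto_iff_norm_sub_tendsto_zero.1
        ((continuous_modulation lam (translation (imPart z₀) φ)).tendsto z₀))
  rw [add_zero] at h1
  refine squeeze_zero (fun _ => norm_nonneg _) (fun z => ?_) h1
  have : schrodinger lam z φ - schrodinger lam z₀ φ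
      = modulation lam z (translation (imPart z) φ - translation (imPart z₀) φ)
        + (modulation lam z (translation (imPart z₀) φ)
          - modulation lam z₀ (translation (imPart z₀) φ)) := by
    rw [map_sub]; simp [schrodinger]
  rw [this]
  refine (norm_add_le _ _).trans ?_
  rw [LinearIsometry.norm_map]

/-! ### The Weyl transform on `L¹(ℂⁿ)` -/

theorem integrable_smul_schrodinger {n : ℕ} (lam : ℝ) (g : L1C n) (φ : L2R n) :
    Integrable fun w : Fin n → ℂ => g w • schrodinger lam w φ := by
  have hg : Integrable g := memLp_one_iff_integrable.1 (Lp.memLp g)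
  refine (hg.norm.mul_const ‖φ‖).mono'
    (hg.1.smul (continuous_schrodinger lam φ).aestronglyMeasurable) ?_
  filter_upwards with w
  rw [norm_smul, LinearIsometry.norm_map]

/-- The Weyl transform `W_λ(g) = ∫ g(w) π_λ(w) dw` of `g ∈ L¹(ℂⁿ)`, a bounded operator on
`L²(ℝⁿ)`; the operator-valued integral is taken in the strong sense (for every `φ`,
`w ↦ g(w) π_λ(w) φ` is Bochner integrable in `L²(ℝⁿ)`). -/
def weylTransform {n : ℕ} (lam : ℝ) (g : L1C n) : L2R n →L[ℂ] L2R n :=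
  LinearMap.mkContinuous
    { toFun := fun φ => ∫ w : Fin n → ℂ, g w • schrodinger lam w φ
      map_add' := fun φ ψ => by
        rw [← integral_add (integrable_smul_schrodinger lam g φ)
          (integrable_smul_schrodinger lam g ψ)]
        simp only [map_add, smul_add]
      map_smul' := fun c φ => by
        rw [RingHom.id_apply, ← integral_smul]
        simp only [map_smul, smul_comm c] }
    (∫ w : Fin n → ℂ, ‖g w‖)
    (fun φ => by
      refine (norm_integral_le_integral_norm _).trans (le_of_eq ?_)
      rw [← integral_mul_const]
      simp only [norm_smul, LinearIsometry.norm_map])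

theorem weylTransform_apply {n : ℕ} (lam : ℝ) (g : L1C n) (φ : L2R n) :
    weylTransform lam g φ = ∫ w : Fin n → ℂ, g w • schrodinger lam w φ := rfl

/-! ### Square integrability of the matrix coefficients of `π = π_1` -/

/-- Plancherel for integrable and square integrable functions on `ℝⁿ`. -/
theorem lintegral_fourier_sq {n : ℕ} {h : EuclideanSpace ℝ (Fin n) → ℂ} (hh : Integrable h)
    (htop : ∫⁻ x, ‖h x‖ₑ ^ (2 : ℝ) ≠ ⊤) :
    ∫⁻ x, ‖FourierTransform.fourier h x‖ₑ ^ (2 : ℝ) = ∫⁻ x, ‖h x‖ₑ ^ (2 : ℝ) := by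
  have h2 : MemLp h 2 volume := by
    refine ⟨hh.1, ?_⟩
    rw [eLpNorm_lt_top_iff_lintegral_rpow_enorm_lt_top (by norm_num) (by norm_num)]
    simpa only [ENNReal.toReal_ofNat] using lt_top_iff_ne_top.2 htop
  set H : L2R n := h2.toLp h with hH
  set F : L2R n := FourierTransform.fourier H with hF
  have hcont : Continuous (FourierTransform.fourier h) :=
    VectorFourier.fourierIntegral_continuous Real.continuous_fourierChar
      (by exact continuous_inner) hh
  have hae : FourierTransform.fourier h =ᵐ[volume] F := by
    refine ae_eq_of_integral_contDiff_smul_eq hcont.locallyIntegrable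
      ((Lp.memLp F).locallyIntegrable (by norm_num)) ?_
    intro g g_smooth g_cpt
    have hg₁ : HasCompactSupport (Complex.ofRealCLM ∘ g) := g_cpt.comp_left rfl
    have hg₂ : ContDiff ℝ (⊤ : ℕ∞) (Complex.ofRealCLM ∘ g) := by fun_prop
    set s : SchwartzMap (EuclideanSpace ℝ (Fin n)) ℂ := hg₁.toSchwartzMap hg₂ with hs
    have e1 : ∫ x, g x • F x = ∫ x, s x • F x := by
      simp [hs]
    have e2 : ∫ x, g x • FourierTransform.fourier h x
        = ∫ x, s x • FourierTransform.fourier h x := by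
      simp [hs]
    have e3 : ∫ x, s x • F x
        = ∫ x, (FourierTransform.fourier s : SchwartzMap _ ℂ) x • H x := by
      rw [← Lp.toTemperedDistribution_apply F s, ← Lp.toTemperedDistribution_apply H,
        hF, ← Lp.fourier_toTemperedDistribution_eq H]
      rfl
    have e4 : ∫ x, (FourierTransform.fourier s : SchwartzMap _ ℂ) x • H x
        = ∫ x, (FourierTransform.fourier s : SchwartzMap _ ℂ) x • h x := by
      refine integral_congr_ae ?_
      filter_upwards [h2.coeFn_toLp] with x hx
      rw [hH, hx]
    have e5 : ∫ x, (FourierTransform.fourier s : SchwartzMap _ ℂ) x • h x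
        = ∫ x, s x • FourierTransform.fourier h x := by
      have := VectorFourier.integral_fourierIntegral_smul_eq_flip
        (L := innerₗ (EuclideanSpace ℝ (Fin n))) (μ := volume) (ν := volume)
        Real.continuous_fourierChar (by exact continuous_inner)
        (f := s) (g := h) s.integrable hh
      rw [flip_innerₗ] at this
      rw [SchwartzMap.fourier_coe]
      exact this
    rw [e1, e2, e3, e4, e5]
  have hn : eLpNorm (FourierTransform.fourier h) 2 volume = eLpNorm h 2 volume := by
    rw [eLpNorm_congr_ae hae, ← eLpNorm_congr_ae h2.coeFn_toLp, ← Lp.enorm_def, ← Lp.enorm_def,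
      ← ofReal_norm, ← ofReal_norm, hF, Lp.norm_fourier_eq]
  have hn2 := congrArg (fun t : ENNReal => t ^ (2 : ℝ)) hn
  beta_reduce at hn2
  rw [eLpNorm_eq_lintegral_rpow_enorm_toReal (by norm_num) (by norm_num),
    eLpNorm_eq_lintegral_rpow_enorm_toReal (by norm_num) (by norm_num),
    ← ENNReal.rpow_mul, ← ENNReal.rpow_mul] at hn2
  simpa using hn2

/-- `(x, y) ↦ x + i y`. -/
def ofReIm {n : ℕ} (p : EuclideanSpace ℝ (Fin n) × EuclideanSpace ℝ (Fin n)) : Fin n → ℂ :=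
  fun j => ⟨p.1 j, p.2 j⟩

theorem rePart_ofReIm {n : ℕ} (p : EuclideanSpace ℝ (Fin n) × EuclideanSpace ℝ (Fin n)) :
    rePart (ofReIm p) = p.1 := rfl

theorem imPart_ofReIm {n : ℕ} (p : EuclideanSpace ℝ (Fin n) × EuclideanSpace ℝ (Fin n)) :
    imPart (ofReIm p) = p.2 := rfl

theorem measurePreserving_ofReIm {n : ℕ} :
    MeasurePreserving (ofReIm (n := n)) volume volume := by
  have h1 := (PiLp.volume_preserving_ofLp (Fin n)).prod (PiLp.volume_preserving_ofLp (Fin n))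
  have h2 := (volume_measurePreserving_arrowProdEquivProdArrow ℝ ℝ (Fin n)).symm
  have h3 := volume_preserving_pi
    (fun _ : Fin n => Complex.volume_preserving_equiv_real_prod.symm)
  exact (h3.comp h2).comp h1

theorem lintegral_comp_smul_inv {n : ℕ} (G : EuclideanSpace ℝ (Fin n) → ENNReal)
    (hG : Measurable G) {r : ℝ} (hr : 0 < r) :
    ∫⁻ x, G (r⁻¹ • x) = ENNReal.ofReal (r ^ n) * ∫⁻ x, G x := by
  have h := Measure.map_addHaar_smul (volume : Measure (EuclideanSpace ℝ (Fin n)))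
    (inv_ne_zero hr.ne')
  rw [← lintegral_map hG (measurable_const_smul (r⁻¹ : ℝ)), h, lintegral_smul_measure]
  congr 2
  rw [finrank_euclideanSpace_fin, inv_pow, inv_inv, abs_of_pos (pow_pos hr n)]

/-- The function `z ↦ ⟨ψ, π(z) φ⟩` (paired so as to be linear in `ψ`). -/
def matrixCoeff {n : ℕ} (φ ψ : L2R n) (z : Fin n → ℂ) : ℂ := inner ℂ (schrodinger 1 z φ) ψ

theorem continuous_matrixCoeff {n : ℕ} (φ ψ : L2R n) : Continuous (matrixCoeff φ ψ) :=
  (continuous_schrodinger 1 φ).inner continuous_const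

theorem integrable_translate_mul {n : ℕ} (φ ψ : L2R n) (y : EuclideanSpace ℝ (Fin n)) :
    Integrable fun ξ => (starRingEnd ℂ) (φ (ξ + y)) * ψ ξ := by
  refine (L2.integrable_inner (𝕜 := ℂ) (translation y φ) ψ).congr ?_
  filter_upwards [coeFn_translation y φ] with ξ h
  rw [h, RCLike.inner_apply, mul_comm]

theorem norm_matrixCoeff {n : ℕ} (φ ψ : L2R n)
    (p : EuclideanSpace ℝ (Fin n) × EuclideanSpace ℝ (Fin n)) :
    ‖matrixCoeff φ ψ (ofReIm p)‖ₑ = ‖FourierTransform.fourier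
      (fun ξ => (starRingEnd ℂ) (φ (ξ + p.2)) * ψ ξ) ((2 * Real.pi)⁻¹ • p.1)‖ₑ := by
  have h1 : matrixCoeff φ ψ (ofReIm p)
      = (starRingEnd ℂ) (Complex.exp (Complex.I * (((1 / 2) * inner ℝ p.1 p.2 : ℝ) : ℂ))) *
        FourierTransform.fourier (fun ξ => (starRingEnd ℂ) (φ (ξ + p.2)) * ψ ξ)
          ((2 * Real.pi)⁻¹ • p.1) := by
    rw [matrixCoeff, L2.inner_def, Real.fourier_eq', ← integral_const_mul]
    refine integral_congr_ae ?_
    filter_upwards [coeFn_schrodinger 1 (ofReIm p) φ] with ξ h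
    rw [h, RCLike.inner_apply, rePart_ofReIm, imPart_ofReIm, map_mul, ← Complex.exp_conj,
      ← Complex.exp_conj, smul_eq_mul]
    have e : (starRingEnd ℂ) (Complex.I * (((1 : ℝ) * (inner ℝ p.1 ξ
          + (1 / 2) * inner ℝ p.1 p.2) : ℝ) : ℂ))
        = (starRingEnd ℂ) (Complex.I * (((1 / 2) * inner ℝ p.1 p.2 : ℝ) : ℂ))
          + ((-2 * Real.pi * inner ℝ ξ ((2 * Real.pi)⁻¹ • p.1) : ℝ) : ℂ) * Complex.I := by
      have hpi : (Real.pi : ℂ) ≠ 0 := by exact_mod_cast Real.pi_ne_zero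
      rw [inner_smul_right, real_inner_comm p.1 ξ, map_mul, map_mul, Complex.conj_I,
        Complex.conj_ofReal, Complex.conj_ofReal]
      push_cast
      field_simp
      ring
    rw [e, Complex.exp_add]
    ring
  have h2 : ‖(starRingEnd ℂ) (Complex.exp (Complex.I * (((1 / 2) * inner ℝ p.1 p.2 : ℝ) : ℂ)))‖ₑ
      = 1 := by
    rw [← ofReal_norm, RCLike.norm_conj, mul_comm Complex.I, Complex.norm_exp_ofReal_mul_I]
    simp
  rw [h1, enorm_mul, h2, one_mul]

theorem lintegral_sq_L2R {n : ℕ} (φ : L2R n) :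
    ∫⁻ ξ, ‖φ ξ‖ₑ ^ (2 : ℝ) = ‖φ‖ₑ ^ (2 : ℝ) := by
  rw [Lp.enorm_def, eLpNorm_eq_lintegral_rpow_enorm_toReal (by norm_num) (by norm_num),
    ← ENNReal.rpow_mul]
  simp

theorem lintegral_matrixCoeff_sq {n : ℕ} (φ ψ : L2R n) :
    ∫⁻ z, ‖matrixCoeff φ ψ z‖ₑ ^ (2 : ℝ)
      = ENNReal.ofReal ((2 * Real.pi) ^ n) * (‖φ‖ₑ ^ (2 : ℝ) * ‖ψ‖ₑ ^ (2 : ℝ)) := by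
  have hm : Measurable fun z => ‖matrixCoeff φ ψ z‖ₑ ^ (2 : ℝ) :=
    (continuous_matrixCoeff φ ψ).measurable.enorm.pow_const _
  have mφ := (Lp.stronglyMeasurable φ).measurable
  have mψ := (Lp.stronglyMeasurable ψ).measurable
  have total : ∫⁻ y, ∫⁻ ξ, ‖φ (ξ + y)‖ₑ ^ (2 : ℝ) * ‖ψ ξ‖ₑ ^ (2 : ℝ)
      = ‖φ‖ₑ ^ (2 : ℝ) * ‖ψ‖ₑ ^ (2 : ℝ) := by
    rw [lintegral_lintegral_swap (by fun_prop)]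
    have : ∀ ξ : EuclideanSpace ℝ (Fin n),
        ∫⁻ y, ‖φ (ξ + y)‖ₑ ^ (2 : ℝ) * ‖ψ ξ‖ₑ ^ (2 : ℝ) = ‖φ‖ₑ ^ (2 : ℝ) * ‖ψ ξ‖ₑ ^ (2 : ℝ) := by
      intro ξ
      rw [lintegral_mul_const _ (by fun_prop),
        lintegral_add_left_eq_self (fun y => ‖φ y‖ₑ ^ (2 : ℝ)) ξ, lintegral_sq_L2R]
    simp_rw [this]
    rw [lintegral_const_mul _ (by fun_prop), lintegral_sq_L2R]
  have hfin : ∀ᵐ y : EuclideanSpace ℝ (Fin n),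
      ∫⁻ ξ, ‖φ (ξ + y)‖ₑ ^ (2 : ℝ) * ‖ψ ξ‖ₑ ^ (2 : ℝ) < ⊤ := by
    refine ae_lt_top ?_ ?_
    · have : Measurable fun p : EuclideanSpace ℝ (Fin n) × EuclideanSpace ℝ (Fin n) =>
          ‖φ (p.2 + p.1)‖ₑ ^ (2 : ℝ) * ‖ψ p.2‖ₑ ^ (2 : ℝ) := by fun_prop
      exact this.lintegral_prod_right'
    · rw [total]
      refine (ENNReal.mul_lt_top ?_ ?_).ne <;>
      exact ENNReal.rpow_lt_top_of_nonneg (by norm_num) enorm_ne_top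
  rw [← measurePreserving_ofReIm.lintegral_comp hm, Measure.volume_eq_prod,
    lintegral_prod_symm' (fun p => ‖matrixCoeff φ ψ (ofReIm p)‖ₑ ^ (2 : ℝ))
      (hm.comp measurePreserving_ofReIm.measurable), ← total,
    ← lintegral_const_mul' _ _ ENNReal.ofReal_ne_top]
  refine lintegral_congr_ae ?_
  filter_upwards [hfin] with y hy
  have hint := integrable_translate_mul φ ψ y
  have hcont : Continuous (FourierTransform.fourier
      (fun ξ => (starRingEnd ℂ) (φ (ξ + y)) * ψ ξ)) :=
    VectorFourier.fourierIntegral_continuous Real.continuous_fourierChar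
      (by exact continuous_inner) hint
  have hsq : ∫⁻ ξ, ‖(starRingEnd ℂ) (φ (ξ + y)) * ψ ξ‖ₑ ^ (2 : ℝ)
      = ∫⁻ ξ, ‖φ (ξ + y)‖ₑ ^ (2 : ℝ) * ‖ψ ξ‖ₑ ^ (2 : ℝ) := by
    refine lintegral_congr fun ξ => ?_
    rw [enorm_mul, ENNReal.mul_rpow_of_nonneg _ _ (by norm_num), ← ofReal_norm, RCLike.norm_conj,
      ofReal_norm]
  simp_rw [norm_matrixCoeff]
  rw [lintegral_comp_smul_inv (fun x => ‖FourierTransform.fourier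
      (fun ξ => (starRingEnd ℂ) (φ (ξ + y)) * ψ ξ) x‖ₑ ^ (2 : ℝ))
      (hcont.measurable.enorm.pow_const _) (by positivity),
    lintegral_fourier_sq hint (by rw [hsq]; exact hy.ne), hsq]

theorem memLp_matrixCoeff {n : ℕ} (φ ψ : L2R n) : MemLp (matrixCoeff φ ψ) 2 volume := by
  refine ⟨(continuous_matrixCoeff φ ψ).aestronglyMeasurable, ?_⟩
  rw [eLpNorm_lt_top_iff_lintegral_rpow_enorm_lt_top (by norm_num) (by norm_num)]
  simp only [ENNReal.toReal_ofNat]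
  rw [lintegral_matrixCoeff_sq φ ψ]
  refine ENNReal.mul_lt_top ENNReal.ofReal_lt_top (ENNReal.mul_lt_top ?_ ?_) <;>
  exact ENNReal.rpow_lt_top_of_nonneg (by norm_num) enorm_ne_top

theorem norm_toLp_matrixCoeff {n : ℕ} (φ ψ : L2R n) :
    ‖(memLp_matrixCoeff φ ψ).toLp _‖ = Real.sqrt ((2 * Real.pi) ^ n) * ‖φ‖ * ‖ψ‖ := by
  rw [Lp.norm_toLp, eLpNorm_eq_lintegral_rpow_enorm_toReal (by norm_num) (by norm_num)]
  simp only [ENNReal.toReal_ofNat]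
  rw [lintegral_matrixCoeff_sq, ← ofReal_norm, ← ofReal_norm,
    ENNReal.ofReal_rpow_of_nonneg (norm_nonneg _) (by norm_num),
    ENNReal.ofReal_rpow_of_nonneg (norm_nonneg _) (by norm_num), ← ENNReal.ofReal_mul (by positivity),
    ← ENNReal.ofReal_mul (by positivity),
    ENNReal.ofReal_rpow_of_nonneg (by positivity) (by norm_num), ← Real.sqrt_eq_rpow,
    ENNReal.toReal_ofReal (Real.sqrt_nonneg _),
    Real.sqrt_mul (by positivity), Real.sqrt_mul (by positivity), Real.rpow_two, Real.rpow_two,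
    Real.sqrt_sq (norm_nonneg _), Real.sqrt_sq (norm_nonneg _), mul_assoc]

/-! ### The Weyl transform on `L²(ℂⁿ)` -/

/-- The bounded linear map `ψ ↦ ⟨ψ, π(·) φ⟩` from `L²(ℝⁿ)` to `L²(ℂⁿ)`. -/
def matrixCoeffCLM {n : ℕ} (φ : L2R n) : L2R n →L[ℂ] L2C n :=
  LinearMap.mkContinuous
    { toFun := fun ψ => (memLp_matrixCoeff φ ψ).toLp _
      map_add' := fun ψ₁ ψ₂ => by
        rw [← MemLp.toLp_add]
        congr 1
        funext z
        exact inner_add_right _ _ _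
      map_smul' := fun c ψ => by
        rw [RingHom.id_apply, ← MemLp.toLp_const_smul]
        congr 1
        funext z
        exact inner_smul_right _ _ _ }
    (Real.sqrt ((2 * Real.pi) ^ n) * ‖φ‖)
    (fun ψ => (norm_toLp_matrixCoeff φ ψ).le)

theorem coeFn_matrixCoeffCLM {n : ℕ} (φ ψ : L2R n) :
    matrixCoeffCLM φ ψ =ᵐ[volume] fun z => inner ℂ (schrodinger 1 z φ) ψ :=
  (memLp_matrixCoeff φ ψ).coeFn_toLp

theorem norm_matrixCoeffCLM_le {n : ℕ} (φ : L2R n) :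
    ‖matrixCoeffCLM φ‖ ≤ Real.sqrt ((2 * Real.pi) ^ n) * ‖φ‖ :=
  LinearMap.mkContinuous_norm_le _ (by positivity) _

theorem matrixCoeffCLM_add {n : ℕ} (φ₁ φ₂ : L2R n) :
    matrixCoeffCLM (φ₁ + φ₂) = matrixCoeffCLM φ₁ + matrixCoeffCLM φ₂ := by
  ext1 ψ
  ext1
  filter_upwards [coeFn_matrixCoeffCLM (φ₁ + φ₂) ψ, coeFn_matrixCoeffCLM φ₁ ψ,
    coeFn_matrixCoeffCLM φ₂ ψ, Lp.coeFn_add (matrixCoeffCLM φ₁ ψ) (matrixCoeffCLM φ₂ ψ)]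
    with z h1 h2 h3 h4
  rw [_root_.add_apply, h1, h4, Pi.add_apply, h2, h3, map_add, inner_add_left]

theorem matrixCoeffCLM_smul {n : ℕ} (c : ℂ) (φ : L2R n) :
    matrixCoeffCLM (c • φ) = (starRingEnd ℂ) c • matrixCoeffCLM φ := by
  ext1 ψ
  ext1
  filter_upwards [coeFn_matrixCoeffCLM (c • φ) ψ, coeFn_matrixCoeffCLM φ ψ,
    Lp.coeFn_smul ((starRingEnd ℂ) c) (matrixCoeffCLM φ ψ)] with z h1 h2 h4
  rw [_root_.smul_apply, h1, h4, Pi.smul_apply, h2, map_smul, inner_smul_left,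
    smul_eq_mul]

/-- The Weyl transform `W(g) = W_1(g) = ∫ g(z) π(z) dz` of `g ∈ L²(ℂⁿ)`, a bounded operator on
`L²(ℝⁿ)`; the operator-valued integral is taken in the weak sense, that is,
`⟨ψ, W(g) φ⟩ = ∫ g(z) ⟨ψ, π(z) φ⟩ dz` for all `φ, ψ`, see `inner_weylTransformL2`. -/
def weylTransformL2 {n : ℕ} : L2C n →L[ℂ] L2R n →L[ℂ] L2R n :=
  LinearMap.mkContinuous₂
    (LinearMap.mk₂ ℂ (fun (g : L2C n) (φ : L2R n) => ContinuousLinearMap.adjoint (matrixCoeffCLM φ) g)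
      (fun g₁ g₂ φ => map_add _ _ _)
      (fun c g φ => map_smul _ _ _)
      (fun g φ₁ φ₂ => by rw [matrixCoeffCLM_add, map_add, _root_.add_apply])
      (fun c g φ => by
        rw [matrixCoeffCLM_smul, map_smulₛₗ, Complex.conj_conj, _root_.smul_apply]))
    (Real.sqrt ((2 * Real.pi) ^ n))
    (fun g φ => by
      rw [LinearMap.mk₂_apply]
      refine (ContinuousLinearMap.le_opNorm _ _).trans ?_
      rw [LinearIsometryEquiv.norm_map]
      refine (mul_le_mul_of_nonneg_right (norm_matrixCoeffCLM_le φ) (norm_nonneg g)).trans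
        (le_of_eq ?_)
      ring)

theorem weylTransformL2_apply {n : ℕ} (g : L2C n) (φ : L2R n) :
    weylTransformL2 g φ = ContinuousLinearMap.adjoint (matrixCoeffCLM φ) g := rfl

theorem inner_weylTransformL2 {n : ℕ} (g : L2C n) (φ ψ : L2R n) :
    Integrable (fun z : Fin n → ℂ => g z * inner ℂ ψ (schrodinger 1 z φ)) ∧
    inner ℂ ψ (weylTransformL2 g φ)
      = ∫ z : Fin n → ℂ, g z * inner ℂ ψ (schrodinger 1 z φ) := by
  have hae : (fun z => inner ℂ (matrixCoeffCLM φ ψ z) (g z)) =ᵐ[volume]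
      fun z : Fin n → ℂ => g z * inner ℂ ψ (schrodinger 1 z φ) := by
    filter_upwards [coeFn_matrixCoeffCLM φ ψ] with z h
    rw [h, RCLike.inner_apply, inner_conj_symm]
  refine ⟨(L2.integrable_inner (𝕜 := ℂ) (matrixCoeffCLM φ ψ) g).congr hae, ?_⟩
  rw [← integral_congr_ae hae, ← L2.inner_def, weylTransformL2_apply,
    ContinuousLinearMap.adjoint_inner_right]

/-! ### The projections `E_A`, `F_B` and the intersection of two projections -/

theorem memLp_indicator {n : ℕ} {A : Set (Fin n → ℂ)} (hA : NullMeasurableSet A volume)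
    (g : L2C n) : MemLp (A.indicator g) 2 volume :=
  (Lp.memLp g).mono ((Lp.aestronglyMeasurable g).indicator₀ hA)
    (Filter.Eventually.of_forall fun z => norm_indicator_le_norm_self _ z)

/-- The orthogonal projection `E_A g = χ_A g` of `L²(ℂⁿ)`, `A` Lebesgue measurable. -/
def projE {n : ℕ} (A : Set (Fin n → ℂ)) (hA : NullMeasurableSet A volume) : L2C n →L[ℂ] L2C n :=
  LinearMap.mkContinuous
    { toFun := fun g => (memLp_indicator hA g).toLp _
      map_add' := fun g₁ g₂ => by
        rw [← MemLp.toLp_add, MemLp.toLp_eq_toLp_iff]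
        filter_upwards [Lp.coeFn_add g₁ g₂] with z h
        have h' := h.trans (Pi.add_apply (⇑g₁) (⇑g₂) z)
        by_cases hz : z ∈ A
        · rw [Set.indicator_of_mem hz, h', Pi.add_apply, Set.indicator_of_mem hz,
            Set.indicator_of_mem hz]
        · rw [Set.indicator_of_notMem hz, Pi.add_apply, Set.indicator_of_notMem hz,
            Set.indicator_of_notMem hz, add_zero]
      map_smul' := fun c g => by
        rw [RingHom.id_apply, ← MemLp.toLp_const_smul, MemLp.toLp_eq_toLp_iff]
        filter_upwards [Lp.coeFn_smul c g] with z h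
        by_cases hz : z ∈ A
        · rw [Set.indicator_of_mem hz, h, Pi.smul_apply, Pi.smul_apply, Set.indicator_of_mem hz]
        · rw [Set.indicator_of_notMem hz, Pi.smul_apply, Set.indicator_of_notMem hz, smul_zero] }
    1
    (fun g => by
      rw [one_mul]
      refine Lp.norm_le_norm_of_ae_le ?_
      filter_upwards [(memLp_indicator hA g).coeFn_toLp] with z h
      change ‖(memLp_indicator hA g).toLp _ z‖ ≤ _
      rw [h]
      exact norm_indicator_le_norm_self _ z)

theorem coeFn_projE {n : ℕ} (A : Set (Fin n → ℂ)) (hA : NullMeasurableSet A volume) (g : L2C n) :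
    projE A hA g =ᵐ[volume] A.indicator g :=
  (memLp_indicator hA g).coeFn_toLp

/-- The subspace of all `g ∈ L²(ℂⁿ)` for which the range of `W(g)` is contained in `B`. -/
def weylRangeIn {n : ℕ} (B : Submodule ℂ (L2R n)) : Submodule ℂ (L2C n) where
  carrier := {g | (weylTransformL2 g).range ≤ B}
  add_mem' := by
    rintro g₁ g₂ h₁ h₂ _ ⟨φ, rfl⟩
    simpa using B.add_mem (h₁ ⟨φ, rfl⟩) (h₂ ⟨φ, rfl⟩)
  zero_mem' := by
    rintro _ ⟨φ, rfl⟩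
    simp
  smul_mem' := by
    rintro c g h _ ⟨φ, rfl⟩
    simpa using B.smul_mem c (h ⟨φ, rfl⟩)

theorem isClosed_weylRangeIn {n : ℕ} {B : Submodule ℂ (L2R n)}
    (hB : IsClosed (B : Set (L2R n))) : IsClosed (weylRangeIn B : Set (L2C n)) := by
  have : (weylRangeIn B : Set (L2C n)) = ⋂ φ : L2R n, {g | weylTransformL2 g φ ∈ B} := by
    ext g
    simp only [Set.mem_iInter, Set.mem_ofPred_eq]
    constructor
    · intro h φ
      exact h ⟨φ, rfl⟩
    · rintro h _ ⟨φ, rfl⟩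
      exact h φ
  rw [this]
  exact isClosed_iInter fun φ => hB.preimage (by fun_prop)

instance completeSpace_weylRangeIn {n : ℕ} (B : Submodule ℂ (L2R n)) [FiniteDimensional ℂ B] :
    CompleteSpace (weylRangeIn B) :=
  (isClosed_weylRangeIn B.closed_of_finiteDimensional).completeSpace_coe

/-- The orthogonal projection `F_B` of `L²(ℂⁿ)` onto the closed subspace
`{g : the range of W(g) is contained in B}`, where `B` is a finite-dimensional subspace of
`L²(ℝⁿ)`; it satisfies `W(F_B g) = P_B W(g)`, see `weylTransformL2_projF`. -/
def projF {n : ℕ} (B : Submodule ℂ (L2R n)) [FiniteDimensional ℂ B] : L2C n →L[ℂ] L2C n :=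
  (weylRangeIn B).starProjection

/-- Matrix coefficients formed with orthogonal vectors are orthogonal. -/
theorem inner_matrixCoeffCLM_eq_zero {n : ℕ} {χ ψ : L2R n} (h : inner ℂ χ ψ = 0) (η φ : L2R n) :
    inner ℂ (matrixCoeffCLM η χ) (matrixCoeffCLM φ ψ) = 0 := by
  have nrm : ∀ φ ψ : L2R n, ‖matrixCoeffCLM φ ψ‖ = Real.sqrt ((2 * Real.pi) ^ n) * ‖φ‖ * ‖ψ‖ :=
    norm_toLp_matrixCoeff
  have diag : ∀ φ : L2R n, inner ℂ (matrixCoeffCLM φ χ) (matrixCoeffCLM φ ψ) = 0 := by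
    intro φ
    have key : ∀ c : ℂ, ‖c‖ = 1 →
        RCLike.re (inner ℂ (matrixCoeffCLM φ χ) (c • matrixCoeffCLM φ ψ)) = 0 := by
      intro c hc
      have e1 := norm_add_sq (𝕜 := ℂ) (matrixCoeffCLM φ χ) (c • matrixCoeffCLM φ ψ)
      have e2 := norm_add_sq (𝕜 := ℂ) χ (c • ψ)
      rw [inner_smul_right, h, mul_zero, map_zero, mul_zero, add_zero, norm_smul, hc, one_mul]
        at e2
      rw [← map_smul, ← map_add, nrm, nrm, nrm, norm_smul, hc, one_mul] at e1
      rw [← map_smul]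
      have e3 := congrArg (fun t => (Real.sqrt ((2 * Real.pi) ^ n) * ‖φ‖) ^ 2 * t) e2
      beta_reduce at e3
      linarith
    have k1 := key 1 (by simp)
    have k2 := key Complex.I (by simp)
    rw [one_smul] at k1
    rw [inner_smul_right] at k2
    apply Complex.ext
    · simpa using k1
    · simpa using k2
  have p1 := diag (φ + η)
  have p2 := diag (φ + Complex.I • η)
  rw [matrixCoeffCLM_add] at p1 p2
  rw [matrixCoeffCLM_smul] at p2
  simp only [_root_.add_apply, _root_.smul_apply, inner_add_left, inner_add_right,
    inner_smul_left, inner_smul_right, diag, map_neg, neg_neg, Complex.conj_I] at p1 p2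
  have hI : Complex.I ≠ 0 := Complex.I_ne_zero
  have : 2 * Complex.I * inner ℂ (matrixCoeffCLM η χ) (matrixCoeffCLM φ ψ) = 0 := by
    linear_combination Complex.I * p1 + p2
  simpa [hI] using this

/-- The relation `W(F_B g) = P_B W(g)`, where `P_B` is the orthogonal projection of `L²(ℝⁿ)`
onto `B`. -/
theorem weylTransformL2_projF {n : ℕ} (B : Submodule ℂ (L2R n)) [FiniteDimensional ℂ B]
    (g : L2C n) : weylTransformL2 (projF B g) = B.starProjection ∘L weylTransformL2 g := by
  have hK : weylTransformL2 (projF B g) = B.starProjection ∘L weylTransformL2 (projF B g) := by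
    ext1 φ
    have hmem : projF B g ∈ weylRangeIn B := Submodule.starProjection_apply_mem _ g
    exact (Submodule.starProjection_eq_self_iff.2 (hmem ⟨φ, rfl⟩)).symm
  have hperp : B.starProjection ∘L weylTransformL2 (g - projF B g) = 0 := by
    ext1 φ
    refine (Submodule.starProjection_apply_eq_zero_iff B).2 ?_
    intro ψ hψ
    rw [ContinuousLinearMap.coe_coe, weylTransformL2_apply, ContinuousLinearMap.adjoint_inner_right]
    refine Submodule.inner_right_of_mem_orthogonal (K := weylRangeIn B) ?_
      (Submodule.sub_starProjection_mem_orthogonal g)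
    rintro _ ⟨η, rfl⟩
    rw [← Submodule.orthogonal_orthogonal B]
    intro χ hχ
    rw [ContinuousLinearMap.coe_coe, weylTransformL2_apply, ContinuousLinearMap.adjoint_inner_right]
    exact inner_matrixCoeffCLM_eq_zero (Submodule.inner_left_of_mem_orthogonal hψ hχ) η φ
  rw [hK]
  rw [map_sub, ContinuousLinearMap.comp_sub, sub_eq_zero] at hperp
  exact hperp.symm

/-- For orthogonal projections `E` and `F` of a Hilbert space, the orthogonal projection `E ∩ F`
onto the intersection of their ranges. (The ranges of orthogonal projections are closed, so that
the closure taken here changes nothing.) -/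
def projInter {H : Type*} [NormedAddCommGroup H] [InnerProductSpace ℂ H] [CompleteSpace H]
    (E F : H →L[ℂ] H) : H →L[ℂ] H :=
  (E.range ⊓ F.range).topologicalClosure.starProjection

end

end HeisenbergWeyl

/-! The argument is that of Amrein and Berthier: two estimates on dimension collide.

Upper bound. If `W(g)` has range in a finite-dimensional `B` with orthonormal basis `e_j`, Weyl
inversion gives `g(z) = (2π)^{-n} ∑ ⟨e_j, W(g) π(-z) e_j⟩` almost everywhere. Hence `weylRangeIn B`
has a reproducing kernel `evalKernel B z` whose norm is bounded uniformly in `z`. Bessel's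
inequality, integrated over `A`, bounds the dimension of any finite-dimensional space of such
functions supported in `A` by a constant times the measure of `A`
(`finrank_le_of_le_vanishingOutside`).

Lower bound. `weylRangeIn B` is stable under twisted translations, which move the support rigidly
and turn `W(g)` into `W(g) π(w)`. Given `g ≠ 0` with support of finite measure, translates can be
chosen one at a time, each protruding from the union of the previous supports by a set of positive
but arbitrarily small measure. Each raises the dimension by one, so `N` dimensions fit into a set of
measure at most that of the support plus one (`exists_finrank_gt`), contradicting the upper bound
for large `N`.

This gives `eq_zero_of_mem_weylRangeIn`, hence (2). For (1), a dilation in `x` reduces `λ` to 1, and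
injectivity of the Weyl transform shows that an integrable symbol of a finite-rank operator agrees
almost everywhere with a square integrable one (`exists_ae_eq_of_weyl`). -/

namespace HeisenbergWeyl

/-! ### Composition law of the operators `π(z)`. -/

/-- The symplectic form `u · y - x · v` of `z = x + i y` and `w = u + i v`. -/
noncomputable def symp {n : ℕ} (z w : Fin n → ℂ) : ℝ :=
  inner ℝ (rePart w) (imPart z) - inner ℝ (rePart z) (imPart w)

/-- The multiplier `exp (i (u · y - x · v) / 2)` of the Schrödinger representation. -/
noncomputable def multiplier {n : ℕ} (z w : Fin n → ℂ) : ℂ :=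
  Complex.exp (((symp z w / 2 : ℝ) : ℂ) * Complex.I)

theorem rePart_add {n : ℕ} (z w : Fin n → ℂ) : rePart (z + w) = rePart z + rePart w := by
  ext j; simp [rePart]

theorem imPart_add {n : ℕ} (z w : Fin n → ℂ) : imPart (z + w) = imPart z + imPart w := by
  ext j; simp [imPart]

theorem rePart_neg {n : ℕ} (z : Fin n → ℂ) : rePart (-z) = -rePart z := by
  ext j; simp [rePart]

theorem imPart_neg {n : ℕ} (z : Fin n → ℂ) : imPart (-z) = -imPart z := by
  ext j; simp [imPart]

theorem continuous_symp_left {n : ℕ} (w : Fin n → ℂ) : Continuous fun z => symp z w := by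
  have h1 := continuous_rePart (n := n)
  have h2 := continuous_imPart (n := n)
  unfold symp; fun_prop

theorem continuous_multiplier_left {n : ℕ} (w : Fin n → ℂ) :
    Continuous fun z => multiplier z w := by
  have h := continuous_symp_left w
  unfold multiplier; fun_prop

theorem norm_multiplier {n : ℕ} (z w : Fin n → ℂ) : ‖multiplier z w‖ = 1 :=
  Complex.norm_exp_ofReal_mul_I _

theorem symp_swap {n : ℕ} (z w : Fin n → ℂ) : symp w z = -symp z w := by
  simp [symp]

theorem schrodinger_comp {n : ℕ} (z w : Fin n → ℂ) (φ : L2R n) :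
    schrodinger 1 z (schrodinger 1 w φ) = multiplier z w • schrodinger 1 (z + w) φ := by
  ext1
  have h := (measurePreserving_add_right volume (imPart z)).quasiMeasurePreserving.ae
    (coeFn_schrodinger 1 w φ)
  filter_upwards [coeFn_schrodinger 1 z (schrodinger 1 w φ), h,
    coeFn_schrodinger 1 (z + w) φ, Lp.coeFn_smul (multiplier z w) (schrodinger 1 (z + w) φ)]
    with ξ h1 h2 h3 h4
  rw [h1, h4, Pi.smul_apply, h3, h2, smul_eq_mul, ← mul_assoc, ← mul_assoc, multiplier,
    ← Complex.exp_add, ← Complex.exp_add, imPart_add, add_assoc, rePart_add, symp]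
  congr 2
  simp only [inner_add_left, inner_add_right]
  push_cast
  ring

theorem schrodinger_neg_apply {n : ℕ} (z : Fin n → ℂ) (φ : L2R n) :
    schrodinger 1 z (schrodinger 1 (-z) φ) = φ := by
  rw [schrodinger_comp, add_neg_cancel]
  have h0 : multiplier z (-z) = 1 := by
    simp [multiplier, symp, rePart_neg, imPart_neg]
  rw [h0, one_smul]
  ext1
  have e1 : imPart (0 : Fin n → ℂ) = 0 := by ext j; simp [imPart]
  have e2 : rePart (0 : Fin n → ℂ) = 0 := by ext j; simp [rePart]
  filter_upwards [coeFn_schrodinger 1 0 φ] with ξ h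
  rw [h, e1, e2]
  simp

theorem inner_schrodinger_left {n : ℕ} (z : Fin n → ℂ) (φ ψ : L2R n) :
    inner ℂ (schrodinger 1 z φ) ψ = inner ℂ φ (schrodinger 1 (-z) ψ) := by
  rw [← LinearIsometry.inner_map_map (schrodinger 1 z) φ, schrodinger_neg_apply]

/-- Since `symp` is antisymmetric, commuting `π(z)` past `π(w)` doubles the phase of the multiplier.
Moving both vectors by `π(w)` thus multiplies a matrix coefficient by a character of `z`; this is
how Fourier uniqueness enters. -/
theorem inner_schrodinger_conj {n : ℕ} (z w : Fin n → ℂ) (φ ψ : L2R n) :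
    inner ℂ (schrodinger 1 w ψ) (schrodinger 1 z (schrodinger 1 w φ))
      = Complex.exp ((symp z w : ℂ) * Complex.I) * inner ℂ ψ (schrodinger 1 z φ) := by
  have h : schrodinger 1 z (schrodinger 1 w φ)
      = Complex.exp ((symp z w : ℂ) * Complex.I) • schrodinger 1 w (schrodinger 1 z φ) := by
    rw [schrodinger_comp, schrodinger_comp, smul_smul, add_comm w z, multiplier, multiplier,
      ← Complex.exp_add, symp_swap z w]
    congr 2
    push_cast
    ring
  rw [h, inner_smul_right, LinearIsometry.inner_map_map]

/-! ### Uniqueness for the Fourier transform of integrable functions -/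

/-- By duality: every test function is the Fourier transform of a Schwartz function `t`, and the
transform can be shifted from `t` onto `f`. -/
theorem ae_eq_zero_of_fourier_eq_zero {V : Type*} [NormedAddCommGroup V] [InnerProductSpace ℝ V]
    [FiniteDimensional ℝ V] [MeasurableSpace V] [BorelSpace V] {f : V → ℂ} (hf : Integrable f)
    (h : ∀ v, FourierTransform.fourier f v = 0) : f =ᵐ[volume] 0 := by
  refine ae_eq_zero_of_integral_contDiff_smul_eq_zero hf.locallyIntegrable ?_
  intro g g_smooth g_cpt
  have hg₁ : HasCompactSupport (Complex.ofRealCLM ∘ g) := g_cpt.comp_left rfl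
  have hg₂ : ContDiff ℝ (⊤ : ℕ∞) (Complex.ofRealCLM ∘ g) := by fun_prop
  set s : SchwartzMap V ℂ := hg₁.toSchwartzMap hg₂ with hs
  set t : SchwartzMap V ℂ := FourierTransformInv.fourierInv s with ht
  have hst : FourierTransform.fourier t = s := FourierTransform.fourier_fourierInv_eq s
  have e1 : ∫ x, g x • f x = ∫ x, s x • f x := by simp [hs]
  have e2 := VectorFourier.integral_fourierIntegral_smul_eq_flip
    (L := innerₗ V) (μ := volume) (ν := volume)
    Real.continuous_fourierChar (by exact continuous_inner) (f := t) (g := f) t.integrable hf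
  rw [flip_innerₗ] at e2
  have e3 : ∫ x, s x • f x = ∫ x, t x • FourierTransform.fourier f x := by
    rw [← hst, SchwartzMap.fourier_coe]
    exact e2
  rw [e1, e3]
  simp [h]

theorem ae_eq_zero_of_symplectic_fourier_eq_zero {n : ℕ} {f : (Fin n → ℂ) → ℂ}
    (hf : Integrable f) (h : ∀ w, ∫ z, Complex.exp ((symp z w : ℂ) * Complex.I) * f z = 0) :
    f =ᵐ[volume] 0 := by
  have hT : MeasurePreserving
      (fun p : WithLp 2 (EuclideanSpace ℝ (Fin n) × EuclideanSpace ℝ (Fin n)) =>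
        ofReIm (WithLp.ofLp p)) volume volume :=
    measurePreserving_ofReIm.comp (WithLp.volume_preserving_ofLp _ _)
  have hzero := ae_eq_zero_of_fourier_eq_zero (hT.integrable_comp_of_integrable hf) (fun v => by
    obtain ⟨⟨a, b⟩, rfl⟩ := WithLp.toLp_surjective 2 v
    -- For `w = -2πb + 2πi a` one has `symp z w = -2π (x · a + y · b)`, the exponent of the ordinary
    -- Fourier transform at `(a, b)`.
    rw [Real.fourier_eq', ← h (ofReIm (-(2 * Real.pi) • b, (2 * Real.pi) • a)), ← hT.map_eq,
      integral_map hT.measurable.aemeasurable]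
    · refine integral_congr_ae (Filter.Eventually.of_forall fun p => ?_)
      obtain ⟨⟨x, y⟩, rfl⟩ := WithLp.toLp_surjective 2 p
      simp only [Function.comp_apply, smul_eq_mul, symp, rePart_ofReIm, imPart_ofReIm,
        WithLp.prod_inner_apply, inner_smul_left, inner_smul_right, real_inner_comm b y]
      congr 3
      simp
      ring
    · rw [hT.map_eq]
      refine AEStronglyMeasurable.mul ?_ hf.1
      have hc := continuous_symp_left (ofReIm (-(2 * Real.pi) • b, (2 * Real.pi) • a))
      exact (by fun_prop : Continuous _).aestronglyMeasurable)
  rw [← eLpNorm_eq_zero_iff hf.1 one_ne_zero, ← eLpNorm_comp_measurePreserving hf.1 hT]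
  exact (eLpNorm_eq_zero_iff (hf.1.comp_measurePreserving hT) one_ne_zero).2 hzero

/-! ### Uniqueness for the Weyl transform -/

instance nontrivial_L2R (n : ℕ) : Nontrivial (L2R n) := by
  refine ⟨indicatorConstLp 2 (measurableSet_ball (x := (0 : EuclideanSpace ℝ (Fin n)))
    (ε := 1)) measure_ball_lt_top.ne (1 : ℂ), 0, ?_⟩
  rw [← norm_ne_zero_iff, norm_indicatorConstLp (by norm_num) (by norm_num)]
  have : (0 : ℝ) < volume.real (Metric.ball (0 : EuclideanSpace ℝ (Fin n)) 1) :=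
    ENNReal.toReal_pos (Metric.measure_ball_pos _ _ one_pos).ne' measure_ball_lt_top.ne
  simpa using this.ne'

/-- A function all of whose pairings with matrix coefficients vanish is zero. -/
theorem ae_eq_zero_of_weyl_eq_zero {n : ℕ} {f : (Fin n → ℂ) → ℂ}
    (hf : ∀ φ ψ : L2R n, Integrable fun z => f z * inner ℂ ψ (schrodinger 1 z φ))
    (h : ∀ φ ψ : L2R n, ∫ z, f z * inner ℂ ψ (schrodinger 1 z φ) = 0) : f =ᵐ[volume] 0 := by
  obtain ⟨φ, hφ⟩ := exists_ne (0 : L2R n)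
  have key : ∀ ψ : L2R n, (fun z => f z * inner ℂ ψ (schrodinger 1 z φ)) =ᵐ[volume] 0 := by
    intro ψ
    refine ae_eq_zero_of_symplectic_fourier_eq_zero (hf φ ψ) fun w => ?_
    rw [← h (schrodinger 1 w φ) (schrodinger 1 w ψ)]
    refine integral_congr_ae (Filter.Eventually.of_forall fun z => ?_)
    simp only [inner_schrodinger_conj]
    ring
  -- Near `z₀`, test against `ψ = π(z₀) φ`: the matrix coefficient is `‖φ‖² ≠ 0` at `z₀`, so it
  -- stays nonzero on a neighbourhood, where `f` must then vanish almost everywhere.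
  refine measure_null_of_locally_null _ fun z₀ _ => ?_
  have hc : Continuous fun z => inner ℂ (schrodinger 1 z₀ φ) (schrodinger 1 z φ) :=
    continuous_const.inner (continuous_schrodinger 1 φ)
  have hU : {z | inner ℂ (schrodinger 1 z₀ φ) (schrodinger 1 z φ) ≠ 0} ∈ nhds z₀ := by
    refine hc.continuousAt.eventually_ne ?_
    rw [LinearIsometry.inner_map_map]
    exact inner_self_ne_zero.2 hφ
  refine ⟨_, inter_mem_nhdsWithin _ hU, measure_mono_null ?_ (key (schrodinger 1 z₀ φ))⟩
  rintro z ⟨hz1, hz2⟩ hz3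
  exact hz1 ((mul_eq_zero.1 hz3).resolve_right hz2)

/-! ### Orthogonality relations and Weyl inversion for finite rank. -/

/-- Polarization in `ψ` of the norm identity `norm_toLp_matrixCoeff`. -/
theorem inner_matrixCoeffCLM_self {n : ℕ} (φ ψ χ : L2R n) :
    inner ℂ (matrixCoeffCLM φ ψ) (matrixCoeffCLM φ χ)
      = (((2 * Real.pi) ^ n * ‖φ‖ ^ 2 : ℝ) : ℂ) * inner ℂ ψ χ := by
  have nrm : ∀ ψ : L2R n,
      ‖matrixCoeffCLM φ ψ‖ ^ 2 = (2 * Real.pi) ^ n * ‖φ‖ ^ 2 * ‖ψ‖ ^ 2 := by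
    intro ψ
    rw [show ‖matrixCoeffCLM φ ψ‖ = Real.sqrt ((2 * Real.pi) ^ n) * ‖φ‖ * ‖ψ‖ from
      norm_toLp_matrixCoeff φ ψ, mul_pow, mul_pow, Real.sq_sqrt (by positivity)]
  have nrm' : ∀ ψ : L2R n, ((‖matrixCoeffCLM φ ψ‖ : ℂ)) ^ 2
      = (((2 * Real.pi) ^ n * ‖φ‖ ^ 2 : ℝ) : ℂ) * (‖ψ‖ : ℂ) ^ 2 := by
    intro ψ
    rw [← Complex.ofReal_pow, nrm]
    push_cast
    ring
  rw [inner_eq_sum_norm_sq_div_four, inner_eq_sum_norm_sq_div_four]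
  simp only [← map_smul, ← map_add, ← map_sub, Complex.coe_algebraMap, nrm']
  ring

/-- The orthogonality relations for matrix coefficients. -/
theorem inner_matrixCoeffCLM {n : ℕ} (φ η ψ χ : L2R n) :
    inner ℂ (matrixCoeffCLM φ ψ) (matrixCoeffCLM η χ)
      = (((2 * Real.pi) ^ n : ℝ) : ℂ) * (inner ℂ η φ * inner ℂ ψ χ) := by
  have diag : ∀ φ : L2R n, inner ℂ (matrixCoeffCLM φ ψ) (matrixCoeffCLM φ χ)
      = (((2 * Real.pi) ^ n : ℝ) : ℂ) * (inner ℂ φ φ * inner ℂ ψ χ) := by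
    intro φ
    have hφ : inner ℂ φ φ = (‖φ‖ : ℂ) ^ 2 := inner_self_eq_norm_sq_to_K φ
    rw [inner_matrixCoeffCLM_self, hφ]
    push_cast
    ring
  -- Polarization in the other variable: both sides are linear in `φ` and antilinear in `η`, so the
  -- diagonal values at `φ + η` and `φ + iη` isolate the off-diagonal term.
  have p1 := diag (φ + η)
  have p2 := diag (φ + Complex.I • η)
  rw [matrixCoeffCLM_add] at p1 p2
  rw [matrixCoeffCLM_smul] at p2
  simp only [_root_.add_apply, _root_.smul_apply, inner_add_left, inner_add_right,
    inner_smul_left, inner_smul_right, diag, map_neg, neg_neg, Complex.conj_I] at p1 p2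
  have hI : Complex.I ≠ 0 := Complex.I_ne_zero
  refine mul_left_cancel₀ hI (mul_left_cancel₀ (two_ne_zero (α := ℂ)) ?_)
  linear_combination (exp := 1) Complex.I * p1 - p2

/-- Every bounded operator with range in a finite-dimensional space is the Weyl transform of a
square integrable function. -/
theorem exists_weylTransformL2_eq {n : ℕ} (B : Submodule ℂ (L2R n)) [FiniteDimensional ℂ B]
    (T : L2R n →L[ℂ] L2R n) (hT : ∀ φ, T φ ∈ B) :
    ∃ h : L2C n, weylTransformL2 h = T ∧
      h = (((2 * Real.pi) ^ n : ℝ) : ℂ)⁻¹ • ∑ j, matrixCoeffCLM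
        (ContinuousLinearMap.adjoint T (stdOrthonormalBasis ℂ B j))
        (stdOrthonormalBasis ℂ B j : L2R n) := by
  -- The witness is the inversion formula `h(z) = (2π)^{-n} tr(T π(z)*)`. A basis of `B` suffices
  -- for the trace because the range of `T` lies in `B`.
  refine ⟨_, ?_, rfl⟩
  ext1 φ
  refine ext_inner_left ℂ fun ψ => ?_
  have hc : (((2 * Real.pi) ^ n : ℝ) : ℂ) ≠ 0 := by
    exact_mod_cast (by positivity : (0 : ℝ) < (2 * Real.pi) ^ n).ne'
  rw [weylTransformL2_apply, ContinuousLinearMap.adjoint_inner_right, inner_smul_right, inner_sum]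
  simp_rw [inner_matrixCoeffCLM, ContinuousLinearMap.adjoint_inner_left]
  rw [← Finset.mul_sum, inv_mul_cancel_left₀ hc]
  have hrep : _ = T φ :=
    congrArg Subtype.val ((stdOrthonormalBasis ℂ B).sum_repr' ⟨T φ, hT φ⟩)
  rw [Submodule.coe_sum] at hrep
  conv_rhs => rw [← hrep]
  rw [inner_sum]
  refine Finset.sum_congr rfl fun j _ => ?_
  rw [Submodule.coe_smul, inner_smul_right]
  rfl

/-- The Weyl symbol of a bounded operator with finite-dimensional range is square integrable. -/
theorem exists_ae_eq_of_weyl {n : ℕ} (B : Submodule ℂ (L2R n)) [FiniteDimensional ℂ B]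
    (T : L2R n →L[ℂ] L2R n) (hT : ∀ φ, T φ ∈ B) {f : (Fin n → ℂ) → ℂ}
    (hf : ∀ φ ψ : L2R n, Integrable fun z => f z * inner ℂ ψ (schrodinger 1 z φ))
    (h : ∀ φ ψ : L2R n, ∫ z, f z * inner ℂ ψ (schrodinger 1 z φ) = inner ℂ ψ (T φ)) :
    ∃ h : L2C n, f =ᵐ[volume] h ∧ weylTransformL2 h = T ∧
      h = (((2 * Real.pi) ^ n : ℝ) : ℂ)⁻¹ • ∑ j, matrixCoeffCLM
        (ContinuousLinearMap.adjoint T (stdOrthonormalBasis ℂ B j))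
        (stdOrthonormalBasis ℂ B j : L2R n) := by
  obtain ⟨g, hg, hg'⟩ := exists_weylTransformL2_eq B T hT
  refine ⟨g, ?_, hg, hg'⟩
  have hsub : ∀ φ ψ : L2R n, (fun z => (f z - g z) * inner ℂ ψ (schrodinger 1 z φ))
      = fun z => f z * inner ℂ ψ (schrodinger 1 z φ) - g z * inner ℂ ψ (schrodinger 1 z φ) :=
    fun φ ψ => funext fun z => sub_mul _ _ _
  have h0 := ae_eq_zero_of_weyl_eq_zero (f := fun z => f z - g z)
    (fun φ ψ => by
      rw [hsub]
      exact (hf φ ψ).sub (inner_weylTransformL2 g φ ψ).1)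
    (fun φ ψ => by
      rw [hsub, integral_sub (hf φ ψ) (inner_weylTransformL2 g φ ψ).1, h,
        ← (inner_weylTransformL2 g φ ψ).2, hg, sub_self])
  filter_upwards [h0] with z hz
  exact sub_eq_zero.1 hz

/-! ### The reproducing kernel of `weylRangeIn B`. -/

/-- The reproducing kernel at `z` of the space of all `g` such that `W(g)` has range in `B`. -/
noncomputable def evalKernel {n : ℕ} (B : Submodule ℂ (L2R n)) [FiniteDimensional ℂ B]
    (z : Fin n → ℂ) : L2C n :=
  (((2 * Real.pi) ^ n : ℝ) : ℂ)⁻¹ • ∑ j, matrixCoeffCLM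
    (schrodinger 1 (-z) (stdOrthonormalBasis ℂ B j)) (stdOrthonormalBasis ℂ B j : L2R n)

/-- Each `π(-z)` is an isometry, so the norms of the summands do not depend on `z`. -/
theorem norm_evalKernel_le {n : ℕ} (B : Submodule ℂ (L2R n)) [FiniteDimensional ℂ B] :
    ∃ C : ℝ, 0 ≤ C ∧ ∀ z, ‖evalKernel B z‖ ≤ C := by
  refine ⟨‖(((2 * Real.pi) ^ n : ℝ) : ℂ)⁻¹‖ * ∑ j, Real.sqrt ((2 * Real.pi) ^ n)
    * ‖stdOrthonormalBasis ℂ B j‖ * ‖stdOrthonormalBasis ℂ B j‖, by positivity, fun z => ?_⟩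
  rw [evalKernel, norm_smul]
  refine mul_le_mul_of_nonneg_left ((norm_sum_le _ _).trans (Finset.sum_le_sum fun j _ => ?_))
    (norm_nonneg _)
  refine (norm_toLp_matrixCoeff _ _).le.trans ?_
  rw [LinearIsometry.norm_map]
  rfl

theorem ae_eq_inner_evalKernel {n : ℕ} (B : Submodule ℂ (L2R n)) [FiniteDimensional ℂ B]
    {g : L2C n} (hg : g ∈ weylRangeIn B) : ∀ᵐ z, g z = inner ℂ (evalKernel B z) g := by
  -- Applied to `g` itself, injectivity of the Weyl transform yields the inversion formula for `g`.
  obtain ⟨h, hgh, -, hh⟩ := exists_ae_eq_of_weyl B (weylTransformL2 g) (fun φ => hg ⟨φ, rfl⟩)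
    (fun φ ψ => (inner_weylTransformL2 g φ ψ).1) (fun φ ψ => (inner_weylTransformL2 g φ ψ).2.symm)
  have hsum : ∀ᵐ z, ∀ j, matrixCoeffCLM
      (ContinuousLinearMap.adjoint (weylTransformL2 g) (stdOrthonormalBasis ℂ B j))
        (stdOrthonormalBasis ℂ B j : L2R n) z = inner ℂ (schrodinger 1 z
      (ContinuousLinearMap.adjoint (weylTransformL2 g) (stdOrthonormalBasis ℂ B j)))
        (stdOrthonormalBasis ℂ B j : L2R n) :=
    ae_all_iff.2 fun j => coeFn_matrixCoeffCLM _ _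
  filter_upwards [hgh, hsum, Lp.coeFn_smul (((2 * Real.pi) ^ n : ℝ) : ℂ)⁻¹ (∑ j, matrixCoeffCLM
        (ContinuousLinearMap.adjoint (weylTransformL2 g) (stdOrthonormalBasis ℂ B j))
        (stdOrthonormalBasis ℂ B j : L2R n)), Lp.coeFn_finsetSum Finset.univ (fun j => matrixCoeffCLM
        (ContinuousLinearMap.adjoint (weylTransformL2 g) (stdOrthonormalBasis ℂ B j))
        (stdOrthonormalBasis ℂ B j : L2R n))] with z h1 h2 h3 h4
  rw [h1, hh, h3, Pi.smul_apply, h4, evalKernel, inner_smul_left, sum_inner, Finset.sum_apply,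
    smul_eq_mul, map_inv₀, Complex.conj_ofReal]
  congr 1
  refine Finset.sum_congr rfl fun j _ => ?_
  rw [h2, inner_schrodinger_left, ContinuousLinearMap.adjoint_inner_left, weylTransformL2_apply,
    ContinuousLinearMap.adjoint_inner_right]

/-! ### Supports and the dimension bound. -/

/-- The subspace of all `g ∈ L²(ℂⁿ)` which vanish almost everywhere outside `A`. -/
def vanishingOutside {n : ℕ} (A : Set (Fin n → ℂ)) : Submodule ℂ (L2C n) where
  carrier := {g | ∀ᵐ z, z ∉ A → g z = 0}
  add_mem' := by
    intro g₁ g₂ h₁ h₂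
    filter_upwards [h₁, h₂, Lp.coeFn_add g₁ g₂] with z e1 e2 e3 hz
    rw [e3, Pi.add_apply, e1 hz, e2 hz, add_zero]
  zero_mem' := by
    change ∀ᵐ z, z ∉ A → (0 : L2C n) z = 0
    simp
  smul_mem' := by
    intro c g h
    filter_upwards [h, Lp.coeFn_smul c g] with z e1 e2 hz
    rw [e2, Pi.smul_apply, e1 hz, smul_zero]

theorem mem_vanishingOutside {n : ℕ} {A : Set (Fin n → ℂ)} {g : L2C n} :
    g ∈ vanishingOutside A ↔ ∀ᵐ z, z ∉ A → g z = 0 := Iff.rfl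

theorem vanishingOutside_mono {n : ℕ} {A A' : Set (Fin n → ℂ)} (h : A ⊆ A') :
    vanishingOutside A ≤ vanishingOutside A' := by
  intro g hg
  filter_upwards [mem_vanishingOutside.1 hg] with z hz hz'
  exact hz fun hA => hz' (h hA)

/-- The trace bound for the product of the projections `E_A` and `F_B`. -/
theorem finrank_le_of_le_vanishingOutside {n : ℕ} (B : Submodule ℂ (L2R n))
    [FiniteDimensional ℂ B] : ∃ C : NNReal, ∀ (A : Set (Fin n → ℂ)), MeasurableSet A →
      ∀ (S : Submodule ℂ (L2C n)) [FiniteDimensional ℂ S],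
      S ≤ weylRangeIn B ⊓ vanishingOutside A → (Module.finrank ℂ S : ENNReal) ≤ C * volume A := by
  obtain ⟨C, hC0, hC⟩ := norm_evalKernel_le B
  -- The constant depends on `B` alone. It must be uniform in `A` and `S`, since both vary in the
  -- counting argument.
  refine ⟨(C ^ 2).toNNReal, fun A hA S _ hS => ?_⟩
  set b := stdOrthonormalBasis ℂ S with hb
  have hon : Orthonormal ℂ fun i => (b i : L2C n) :=
    b.orthonormal.comp_linearIsometry S.subtypeₗᵢ
  have hnorm : ∀ i, ∫⁻ z, ‖(b i : L2C n) z‖ₑ ^ (2 : ℝ) = 1 := by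
    intro i
    have h1 : ‖(b i : L2C n)‖ₑ = 1 := by
      rw [← ofReal_norm, hon.1 i, ENNReal.ofReal_one]
    rw [Lp.enorm_def, eLpNorm_eq_lintegral_rpow_enorm_toReal (by norm_num) (by norm_num)] at h1
    have h2 := congrArg (fun t : ENNReal => t ^ (2 : ℝ)) h1
    beta_reduce at h2
    rw [← ENNReal.rpow_mul] at h2
    simpa using h2
  calc (Module.finrank ℂ S : ENNReal)
      = ∑ i, ∫⁻ z, ‖(b i : L2C n) z‖ₑ ^ (2 : ℝ) := by
        rw [Finset.sum_congr rfl fun i _ => hnorm i]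
        simp
    _ = ∫⁻ z, ∑ i, ‖(b i : L2C n) z‖ₑ ^ (2 : ℝ) := by
        rw [lintegral_finsetSum]
        intro i _
        exact (Lp.stronglyMeasurable _).measurable.enorm.pow_const _
    _ ≤ ∫⁻ z, A.indicator (fun _ => ENNReal.ofReal (C ^ 2)) z := by
        refine lintegral_mono_ae ?_
        have e1 : ∀ᵐ z, ∀ i, (b i : L2C n) z = inner ℂ (evalKernel B z) (b i : L2C n) :=
          ae_all_iff.2 fun i => ae_eq_inner_evalKernel B (hS (b i).2).1
        have e2 : ∀ᵐ z, ∀ i, z ∉ A → (b i : L2C n) z = 0 :=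
          ae_all_iff.2 fun i => mem_vanishingOutside.1 (hS (b i).2).2
        filter_upwards [e1, e2] with z h1 h2
        by_cases hz : z ∈ A
        · rw [Set.indicator_of_mem hz]
          -- At a fixed `z` the values of the basis functions are, up to conjugation, the
          -- coefficients of the kernel at `z`; Bessel bounds their square sum independently of the
          -- dimension of `S`.
          have hbes := hon.sum_inner_products_le (evalKernel B z) (s := Finset.univ)
          have hle : ∑ i, ‖(b i : L2C n) z‖ ^ 2 ≤ C ^ 2 := by
            calc ∑ i, ‖(b i : L2C n) z‖ ^ 2
                = ∑ i, ‖inner ℂ (b i : L2C n) (evalKernel B z)‖ ^ 2 := by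
                  refine Finset.sum_congr rfl fun i _ => ?_
                  rw [h1 i, norm_inner_symm]
              _ ≤ ‖evalKernel B z‖ ^ 2 := hbes
              _ ≤ C ^ 2 := pow_le_pow_left₀ (norm_nonneg _) (hC z) 2
          have hcast : ∀ i, ‖(b i : L2C n) z‖ₑ ^ (2 : ℝ)
              = ENNReal.ofReal (‖(b i : L2C n) z‖ ^ 2) := by
            intro i
            rw [ENNReal.rpow_two, ENNReal.ofReal_pow (norm_nonneg _), ofReal_norm]
          simp_rw [hcast]
          rw [← ENNReal.ofReal_sum_of_nonneg fun i _ => by positivity]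
          exact ENNReal.ofReal_le_ofReal hle
        · simp [h2 _ hz]
    _ = _ := lintegral_indicator_const hA _

/-! ### Twisted translations. -/

theorem memLp_twistedTranslate {n : ℕ} (w : Fin n → ℂ) (g : L2C n) :
    MemLp (fun z => multiplier (z - w) w * g (z - w)) 2 volume := by
  have hg := (Lp.memLp g).comp_measurePreserving (measurePreserving_sub_right volume w)
  refine hg.congr_norm (AEStronglyMeasurable.mul ?_ hg.1) ?_
  · exact ((continuous_multiplier_left w).comp (continuous_sub_right w)).aestronglyMeasurable
  · filter_upwards with z
    rw [norm_mul, norm_multiplier, one_mul]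
    rfl

/-- The twisted translate of `g` by `w`, whose Weyl transform is `W(g) π(w)`. -/
noncomputable def twistedTranslate {n : ℕ} (w : Fin n → ℂ) (g : L2C n) : L2C n :=
  (memLp_twistedTranslate w g).toLp _

theorem coeFn_twistedTranslate {n : ℕ} (w : Fin n → ℂ) (g : L2C n) :
    twistedTranslate w g =ᵐ[volume] fun z => multiplier (z - w) w * g (z - w) :=
  (memLp_twistedTranslate w g).coeFn_toLp

/-- After the substitution `z ↦ z + w`, the multiplier is exactly the factor in `π(z) π(w)`.
Precomposition with `π(w)` cannot enlarge the range, whence the stability of `weylRangeIn B`. -/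
theorem weylTransformL2_twistedTranslate {n : ℕ} (w : Fin n → ℂ) (g : L2C n) (φ : L2R n) :
    weylTransformL2 (twistedTranslate w g) φ = weylTransformL2 g (schrodinger 1 w φ) := by
  refine ext_inner_left ℂ fun ψ => ?_
  rw [(inner_weylTransformL2 _ _ _).2, (inner_weylTransformL2 _ _ _).2]
  have h1 : ∫ z, twistedTranslate w g z * inner ℂ ψ (schrodinger 1 z φ)
      = ∫ z, (fun z => multiplier z w * g z * inner ℂ ψ (schrodinger 1 (z + w) φ)) (z - w) := by
    refine integral_congr_ae ?_
    filter_upwards [coeFn_twistedTranslate w g] with z hz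
    simp only [hz, sub_add_cancel]
  rw [h1, integral_sub_right_eq_self
    (fun z => multiplier z w * g z * inner ℂ ψ (schrodinger 1 (z + w) φ)) w]
  refine integral_congr_ae (Filter.Eventually.of_forall fun z => ?_)
  simp only [schrodinger_comp, inner_smul_right]
  ring

theorem twistedTranslate_mem_weylRangeIn {n : ℕ} {B : Submodule ℂ (L2R n)} {g : L2C n}
    (hg : g ∈ weylRangeIn B) (w : Fin n → ℂ) : twistedTranslate w g ∈ weylRangeIn B := by
  rintro _ ⟨φ, rfl⟩
  rw [ContinuousLinearMap.coe_coe, weylTransformL2_twistedTranslate]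
  exact hg ⟨_, rfl⟩

/-- The multiplier never vanishes, so the support of the twisted translate is the plain translate of
the support, up to a null set. -/
theorem twistedTranslate_mem_vanishingOutside {n : ℕ} {A : Set (Fin n → ℂ)} {g : L2C n}
    {w : Fin n → ℂ} : twistedTranslate w g ∈ vanishingOutside A ↔
      volume ((fun z => z - w) ⁻¹' {z | g z ≠ 0} \ A) = 0 := by
  rw [mem_vanishingOutside, measure_eq_zero_iff_ae_notMem]
  have hne : ∀ z, multiplier (z - w) w ≠ 0 := fun z => by
    rw [← norm_ne_zero_iff, norm_multiplier]
    exact one_ne_zero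
  refine Filter.eventually_congr ?_
  filter_upwards [coeFn_twistedTranslate w g] with z hz
  rw [hz, mul_eq_zero, or_iff_right (hne z), Set.mem_sdiff, Set.mem_preimage, Set.mem_ofPred_eq]
  tauto

/-! ### Small translates -/

/-- Removing the same `A` from two sets can only shrink their symmetric difference, so this follows
from continuity of translation in measure. -/
theorem continuous_measureReal_translate_diff {n : ℕ} {A₀ A : Set (Fin n → ℂ)}
    (hA₀ : MeasurableSet A₀) (hA : MeasurableSet A) (h₀ : volume A₀ ≠ ⊤) :
    Continuous fun w => volume.real ((fun z => z - w) ⁻¹' A₀ \ A) := by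
  have hF : Continuous fun w : Fin n → ℂ =>
      (⟨fun z => z - w, by fun_prop⟩ : C(Fin n → ℂ, Fin n → ℂ)) := by
    refine ContinuousMap.continuous_of_continuous_uncurry _ ?_
    change Continuous fun p : (Fin n → ℂ) × (Fin n → ℂ) => p.2 - p.1
    fun_prop
  have hfin : ∀ w, volume ((fun z => z - w) ⁻¹' A₀) ≠ ⊤ := fun w => by
    rwa [(measurePreserving_sub_right volume w).measure_preimage hA₀.nullMeasurableSet]
  have hmeas : ∀ w, MeasurableSet ((fun z => z - w) ⁻¹' A₀) := fun w =>
    (measurable_sub_const w) hA₀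
  rw [continuous_iff_continuousAt]
  intro w₀
  have ht := tendsto_measure_symmDiff_preimage_nhds_zero (hF.tendsto w₀)
    (Filter.Eventually.of_forall fun w => measurePreserving_sub_right volume w)
    (measurePreserving_sub_right volume w₀) hA₀.nullMeasurableSet h₀
  have ht' := (ENNReal.tendsto_toReal ENNReal.zero_ne_top).comp ht
  rw [ContinuousAt, tendsto_iff_dist_tendsto_zero]
  refine squeeze_zero (fun _ => dist_nonneg) (fun w => ?_) ht'
  have hs : volume (symmDiff ((fun z => z - w) ⁻¹' A₀) ((fun z => z - w₀) ⁻¹' A₀)) ≠ ⊤ :=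
    measure_ne_top_of_subset Set.symmDiff_subset_union
      (measure_union_ne_top (hfin w) (hfin w₀))
  rw [Real.dist_eq]
  refine (abs_measureReal_sub_le_measureReal_symmDiff'
    ((hmeas w).diff hA).nullMeasurableSet ((hmeas w₀).diff hA).nullMeasurableSet
    (measure_ne_top_of_subset Set.sdiff_subset (hfin w))
    (measure_ne_top_of_subset Set.sdiff_subset (hfin w₀))).trans ?_
  refine measureReal_mono ?_ hs
  intro z hz
  simp only [Set.mem_symmDiff, Set.mem_sdiff] at hz ⊢
  tauto

/-- Tonelli. The right-hand side is positive when `A₀` is not null and `A` has finite measure in a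
space of infinite measure, so some translate of `A₀` must protrude from `A`. -/
theorem lintegral_measure_translate_diff {n : ℕ} {A₀ A : Set (Fin n → ℂ)}
    (hA₀ : MeasurableSet A₀) (hA : MeasurableSet A) :
    ∫⁻ w, volume ((fun z => z - w) ⁻¹' A₀ \ A) = volume A₀ * volume Aᶜ := by
  have h1 : ∀ w, volume ((fun z => z - w) ⁻¹' A₀ \ A)
      = ∫⁻ z, A₀.indicator 1 (z - w) * Aᶜ.indicator 1 z := by
    intro w
    rw [← lintegral_indicator_one ((measurable_sub_const w hA₀).diff hA)]
    refine lintegral_congr fun z => ?_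
    by_cases h : z - w ∈ A₀ <;> by_cases h' : z ∈ A <;> simp [h, h']
  have m1 : Measurable (A₀.indicator (1 : (Fin n → ℂ) → ENNReal)) :=
    measurable_one.indicator hA₀
  have m2 : Measurable (Aᶜ.indicator (1 : (Fin n → ℂ) → ENNReal)) :=
    measurable_one.indicator hA.compl
  simp_rw [h1]
  rw [lintegral_lintegral_swap (by fun_prop)]
  have h2 : ∀ z : Fin n → ℂ, ∫⁻ w, A₀.indicator 1 (z - w) * Aᶜ.indicator 1 z
      = volume A₀ * Aᶜ.indicator 1 z := by
    intro z
    rw [lintegral_mul_const _ (by fun_prop),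
      lintegral_sub_left_eq_self (fun w => A₀.indicator (1 : (Fin n → ℂ) → ENNReal) w) z,
      lintegral_indicator_one hA₀]
  simp_rw [h2]
  rw [lintegral_const_mul _ m2, lintegral_indicator_one hA.compl]

/-- Intermediate value theorem on the connected space `ℂⁿ`: the protruding measure is continuous in
`w`, zero at `w = 0` because `A₀ ⊆ A`, and positive somewhere. -/
theorem exists_measure_translate_diff_le {n : ℕ} (hn : 1 ≤ n) {A₀ A : Set (Fin n → ℂ)}
    (hA₀ : MeasurableSet A₀) (hA : MeasurableSet A) (hsub : A₀ ⊆ A) (h₀ : volume A₀ ≠ 0)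
    (hfin : volume A ≠ ⊤) {ε : ℝ} (hε : 0 < ε) :
    ∃ w, volume ((fun z => z - w) ⁻¹' A₀ \ A) ≠ 0 ∧
      volume ((fun z => z - w) ⁻¹' A₀ \ A) ≤ ENNReal.ofReal ε := by
  -- For `n ≥ 1` the space is noncompact, hence of infinite volume; for `n = 0` it is a point and
  -- the claim fails.
  have : Nonempty (Fin n) := ⟨⟨0, hn⟩⟩
  have h₀fin : volume A₀ ≠ ⊤ := measure_ne_top_of_subset hsub hfin
  have hf : ∀ w, volume ((fun z => z - w) ⁻¹' A₀ \ A) ≠ ⊤ := fun w =>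
    measure_ne_top_of_subset Set.sdiff_subset (by
      rwa [(measurePreserving_sub_right volume w).measure_preimage hA₀.nullMeasurableSet])
  have hpos : ∃ w, volume ((fun z => z - w) ⁻¹' A₀ \ A) ≠ 0 := by
    by_contra! h
    have hint := lintegral_measure_translate_diff hA₀ hA
    simp only [h, lintegral_zero] at hint
    have hc : volume Aᶜ = ⊤ := by
      rw [measure_compl hA hfin, measure_univ_of_isAddLeftInvariant, ENNReal.top_sub hfin]
    rw [hc, ENNReal.mul_top h₀] at hint
    exact ENNReal.zero_ne_top hint
  obtain ⟨w₁, hw₁⟩ := hpos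
  have hr₁ : 0 < volume.real ((fun z => z - w₁) ⁻¹' A₀ \ A) := ENNReal.toReal_pos hw₁ (hf w₁)
  obtain ⟨w, hw⟩ := mem_range_of_exists_le_of_exists_ge
    (continuous_measureReal_translate_diff hA₀ hA h₀fin)
    (c := min ε (volume.real ((fun z => z - w₁) ⁻¹' A₀ \ A)))
    ⟨0, by simp [Set.sdiff_eq_empty.2 hsub, hε.le]⟩ ⟨w₁, min_le_right _ _⟩
  refine ⟨w, fun h => ?_, ?_⟩
  · simp only [measureReal_def, h] at hw
    exact (lt_min hε hr₁).ne hw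
  · rw [← ENNReal.ofReal_toReal (hf w)]
    exact ENNReal.ofReal_le_ofReal (hw.le.trans (min_le_left _ _))

/-! ### The Amrein–Berthier argument -/

/-- Induction on `k`, adjoining one twisted translate of `g` at a cost of at most `ε` in measure.
Keeping the support of `g` inside `A` lets the translation `w = 0` serve as the starting point for
the next choice. -/
theorem exists_finrank_gt {n : ℕ} (hn : 1 ≤ n) (B : Submodule ℂ (L2R n)) {g : L2C n}
    (hg : g ∈ weylRangeIn B) (hg0 : g ≠ 0) (hfin : volume {z | g z ≠ 0} ≠ ⊤) {ε : ℝ}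
    (hε : 0 < ε) (k : ℕ) :
    ∃ A : Set (Fin n → ℂ), MeasurableSet A ∧ {z | g z ≠ 0} ⊆ A ∧
      volume A ≤ volume {z | g z ≠ 0} + k * ENNReal.ofReal ε ∧
      ∃ S : Submodule ℂ (L2C n), FiniteDimensional ℂ S ∧
        S ≤ weylRangeIn B ⊓ vanishingOutside A ∧ k ≤ Module.finrank ℂ S := by
  have hmeas : MeasurableSet {z | g z ≠ 0} :=
    (Lp.stronglyMeasurable g).measurable (measurableSet_singleton 0).compl
  have hne : volume {z | g z ≠ 0} ≠ 0 := by
    intro h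
    exact hg0 ((Lp.eq_zero_iff_ae_eq_zero).2 h)
  induction k with
  | zero => exact ⟨_, hmeas, subset_rfl, by simp, ⊥, inferInstance, bot_le, by simp⟩
  | succ k ih =>
    obtain ⟨A, hA, hsub, hvol, S, hS, hSA, hk⟩ := ih
    have hAfin : volume A ≠ ⊤ := by
      refine ne_top_of_le_ne_top ?_ hvol
      exact ENNReal.add_ne_top.2
        ⟨hfin, ENNReal.mul_ne_top (ENNReal.natCast_ne_top k) ENNReal.ofReal_ne_top⟩
    obtain ⟨w, hw0, hw⟩ := exists_measure_translate_diff_le hn hmeas hA hsub hne hAfin hε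
    have hA' : A ∪ (fun z => z - w) ⁻¹' {z | g z ≠ 0}
        = A ∪ ((fun z => z - w) ⁻¹' {z | g z ≠ 0} \ A) := Set.union_sdiff_self.symm
    refine ⟨A ∪ (fun z => z - w) ⁻¹' {z | g z ≠ 0}, hA.union (measurable_sub_const w hmeas),
      hsub.trans Set.subset_union_left, ?_, S ⊔ Submodule.span ℂ {twistedTranslate w g},
      inferInstance, ?_, ?_⟩
    · rw [hA']
      refine (measure_union_le _ _).trans ((add_le_add hvol hw).trans (le_of_eq ?_))
      push_cast
      ring
    · refine sup_le (hSA.trans (inf_le_inf_left _ (vanishingOutside_mono Set.subset_union_left))) ?_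
      rw [Submodule.span_singleton_le_iff_mem]
      refine ⟨twistedTranslate_mem_weylRangeIn hg w, ?_⟩
      rw [SetLike.mem_coe, twistedTranslate_mem_vanishingOutside, Set.sdiff_eq_empty.2 Set.subset_union_right,
        measure_empty]
    · refine Nat.succ_le_of_lt (hk.trans_lt (Submodule.finrank_lt_finrank_of_lt ?_))
      -- Functions in `S` vanish outside `A`, whereas the new translate is nonzero on a set of
      -- positive measure there; so it is not in `S`.
      refine lt_of_le_of_ne le_sup_left fun h => hw0 ?_
      have hmem : twistedTranslate w g ∈ S := by
        rw [h]
        exact Submodule.mem_sup_right (Submodule.mem_span_singleton_self _)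
      exact twistedTranslate_mem_vanishingOutside.1 (hSA hmem).2

/-- A square integrable function supported in a set of finite measure whose Weyl transform has
finite-dimensional range is zero. -/
theorem eq_zero_of_mem_weylRangeIn {n : ℕ} (hn : 1 ≤ n) (B : Submodule ℂ (L2R n))
    [FiniteDimensional ℂ B] {g : L2C n} (hg : g ∈ weylRangeIn B) {A : Set (Fin n → ℂ)}
    (hA : volume A ≠ ⊤) (hgA : g ∈ vanishingOutside A) : g = 0 := by
  by_contra hg0
  -- `A` is replaced by the support of `g`, which is measurable and still of finite measure.
  have hfin : volume {z | g z ≠ 0} ≠ ⊤ := by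
    refine ne_top_of_le_ne_top hA (measure_mono_ae ?_)
    filter_upwards [mem_vanishingOutside.1 hgA] with z hz hz'
    by_contra hzA
    exact hz' (hz hzA)
  obtain ⟨C, hC⟩ := finrank_le_of_le_vanishingOutside B
  -- With `ε = 1 / N`, the `N` enlargements add at most 1 to the measure in total, so the upper
  -- bound on the dimension does not grow with `N`.
  obtain ⟨N, hN⟩ := exists_nat_gt ((C * (volume {z | g z ≠ 0} + 1)).toReal)
  have hN0 : 0 < N := by
    have : (0 : ℝ) < N := ENNReal.toReal_nonneg.trans_lt hN
    exact_mod_cast this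
  obtain ⟨A', hA', -, hvol, S, hS, hSA, hk⟩ :=
    exists_finrank_gt hn B hg hg0 hfin (ε := 1 / N) (by positivity) N
  have hone : (N : ENNReal) * ENNReal.ofReal (1 / N) = 1 := by
    rw [← ENNReal.ofReal_natCast, ← ENNReal.ofReal_mul (by positivity), mul_one_div_cancel
      (by positivity), ENNReal.ofReal_one]
  rw [hone] at hvol
  have hle : (N : ENNReal) ≤ C * (volume {z | g z ≠ 0} + 1) :=
    calc (N : ENNReal) ≤ Module.finrank ℂ S := by exact_mod_cast hk
      _ ≤ C * volume A' := hC A' hA' S hSA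
      _ ≤ _ := by gcongr
  have := ENNReal.toReal_mono (ENNReal.mul_ne_top ENNReal.coe_ne_top
    (ENNReal.add_ne_top.2 ⟨hfin, ENNReal.one_ne_top⟩)) hle
  rw [ENNReal.toReal_natCast] at this
  exact absurd hN this.not_gt

/-! ### The statement on projections. -/

theorem projInter_projE_projF {n : ℕ} (hn : 1 ≤ n) {A : Set (Fin n → ℂ)}
    (hA : NullMeasurableSet A volume) (hfin : volume A ≠ ⊤) (B : Submodule ℂ (L2R n))
    [FiniteDimensional ℂ B] : projInter (projE A hA) (projF B) = 0 := by
  have hbot : (projE A hA).range ⊓ (projF B).range = ⊥ := by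
    rw [eq_bot_iff]
    rintro g ⟨⟨f, hf⟩, ⟨h, hh⟩⟩
    refine eq_zero_of_mem_weylRangeIn hn B ?_ hfin ?_
    · rw [← hh]
      exact Submodule.starProjection_apply_mem _ h
    · rw [← hf, mem_vanishingOutside]
      filter_upwards [coeFn_projE A hA f] with z hz hzA
      exact hz.trans (Set.indicator_of_notMem hzA _)
  have hcl : ((projE A hA).range ⊓ (projF B).range).topologicalClosure = ⊥ := by
    rw [hbot]
    exact (Submodule.closed_of_finiteDimensional ⊥).submodule_topologicalClosure_eq
  ext1 g
  have hmem : projInter (projE A hA) (projF B) g ∈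
      ((projE A hA).range ⊓ (projF B).range).topologicalClosure :=
    Submodule.starProjection_apply_mem _ g
  rw [hcl] at hmem
  exact hmem

/-! ### Reduction of general `λ` to `λ = 1`. -/

/-- The dilation `x + i y ↦ a x + i y`. -/
def dilateRe {n : ℕ} (a : ℝ) : (Fin n → ℂ) →ₗ[ℝ] (Fin n → ℂ) where
  toFun z := fun j => ⟨a * (z j).re, (z j).im⟩
  map_add' z w := by
    funext j
    apply Complex.ext <;> simp [mul_add]
  map_smul' c z := by
    funext j
    apply Complex.ext <;> simp [mul_left_comm]

theorem det_dilateRe_ne_zero {n : ℕ} {a : ℝ} (ha : a ≠ 0) :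
    LinearMap.det (dilateRe (n := n) a) ≠ 0 := by
  have h : dilateRe (n := n) a ∘ₗ dilateRe a⁻¹ = LinearMap.id := by
    refine LinearMap.ext fun z => ?_
    funext j
    apply Complex.ext <;> simp [dilateRe, ha]
  intro h0
  have h1 := congrArg LinearMap.det h
  rw [LinearMap.det_comp, h0, zero_mul, LinearMap.det_id] at h1
  exact zero_ne_one h1

/-- The phase depends on `λ` and `x` only through `λ x`, and the translation only on `y`. -/
theorem schrodinger_eq_dilateRe {n : ℕ} {lam : ℝ} (hlam : lam ≠ 0) (z : Fin n → ℂ) (φ : L2R n) :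
    schrodinger 1 z φ = schrodinger lam (dilateRe lam⁻¹ z) φ := by
  ext1
  have him : imPart (dilateRe lam⁻¹ z) = imPart z := rfl
  have hre : rePart (dilateRe lam⁻¹ z) = lam⁻¹ • rePart z := rfl
  filter_upwards [coeFn_schrodinger 1 z φ, coeFn_schrodinger lam (dilateRe lam⁻¹ z) φ]
    with ξ h1 h2
  rw [h1, h2, him, hre, inner_smul_left, inner_smul_left]
  congr 4
  rw [starRingEnd_apply, star_trivial]
  field_simp

theorem inner_weylTransform {n : ℕ} (lam : ℝ) (g : L1C n) (φ ψ : L2R n) :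
    Integrable (fun z : Fin n → ℂ => g z * inner ℂ ψ (schrodinger lam z φ)) ∧
    inner ℂ ψ (weylTransform lam g φ) = ∫ z, g z * inner ℂ ψ (schrodinger lam z φ) := by
  have hint := integrable_smul_schrodinger lam g φ
  refine ⟨?_, ?_⟩
  · simpa only [inner_smul_right] using hint.const_inner (𝕜 := ℂ) ψ
  · rw [weylTransform_apply, ← integral_inner hint]
    simp only [inner_smul_right]

/-- The pullback of `g` under `x ↦ x / λ` has Weyl transform at parameter 1 equal to a scalar
multiple of `weylTransform lam g`. It is a priori only integrable; finite rank makes it square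
integrable, so that `eq_zero_of_mem_weylRangeIn` applies. -/
theorem eq_zero_of_finiteDimensional_range_weylTransform {n : ℕ} (hn : 1 ≤ n)
    {A : Set (Fin n → ℂ)} (hA : volume A ≠ ⊤) {lam : ℝ} (hlam : lam ≠ 0) {g : L1C n}
    (hg : ∀ᵐ z : Fin n → ℂ, z ∉ A → g z = 0)
    (hB : FiniteDimensional ℂ (weylTransform lam g).range) : g = 0 := by
  set E : (Fin n → ℂ) →ₗ[ℝ] (Fin n → ℂ) := dilateRe lam⁻¹ with hE
  have hdet : LinearMap.det E ≠ 0 := det_dilateRe_ne_zero (inv_ne_zero hlam)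
  have hmeas : Measurable E := E.continuous_of_finiteDimensional.measurable
  have hmap := Measure.map_linearMap_addHaar_eq_smul_addHaar
    (volume : Measure (Fin n → ℂ)) hdet
  set c : ENNReal := ENNReal.ofReal |(LinearMap.det E)⁻¹| with hc
  have hc0 : c ≠ 0 := by
    rw [hc, ne_eq, ENNReal.ofReal_eq_zero, not_le]
    positivity
  have hctop : c ≠ ⊤ := ENNReal.ofReal_ne_top
  have hpre : ∀ s : Set (Fin n → ℂ), volume (E ⁻¹' s) = c * volume s :=
    Measure.addHaar_preimage_linearMap volume hdet
  have hcomp : ∀ {G : (Fin n → ℂ) → ℂ}, Integrable G → Integrable (fun z => G (E z)) ∧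
      ∫ z, G (E z) = (c.toReal : ℂ) * ∫ z, G z := by
    intro G hG
    have hG' : Integrable G (Measure.map E volume) := by
      rw [hmap]
      exact hG.smul_measure hctop
    refine ⟨hG'.comp_measurable hmeas, ?_⟩
    rw [← integral_map hmeas.aemeasurable hG'.1, hmap, integral_smul_measure,
      Complex.real_smul]
  have hfun : ∀ φ ψ : L2R n, (fun z => g (E z) * inner ℂ ψ (schrodinger 1 z φ))
      = fun z => (fun u => g u * inner ℂ ψ (schrodinger lam u φ)) (E z) := by
    intro φ ψ
    funext z
    rw [schrodinger_eq_dilateRe hlam]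
  -- The scalar `c` is the Jacobian factor of the change of variables.
  obtain ⟨h, hgh, hW, -⟩ := exists_ae_eq_of_weyl (weylTransform lam g).range
    ((c.toReal : ℂ) • weylTransform lam g)
    (fun φ => Submodule.smul_mem _ _ ⟨φ, rfl⟩) (f := fun z => g (E z))
    (fun φ ψ => by
      rw [hfun]
      exact (hcomp (inner_weylTransform lam g φ ψ).1).1)
    (fun φ ψ => by
      rw [hfun, (hcomp (inner_weylTransform lam g φ ψ).1).2, ← (inner_weylTransform lam g φ ψ).2,
        _root_.smul_apply, inner_smul_right])
  have hh : h = 0 := by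
    refine eq_zero_of_mem_weylRangeIn hn (weylTransform lam g).range (A := E ⁻¹' A) ?_ ?_ ?_
    · rintro _ ⟨φ, rfl⟩
      rw [hW]
      exact Submodule.smul_mem _ _ ⟨φ, rfl⟩
    · rw [hpre]
      exact ENNReal.mul_ne_top hctop hA
    · have hgE : ∀ᵐ z, E z ∉ A → g (E z) = 0 := by
        rw [ae_iff] at hg ⊢
        have := hpre {z | ¬(z ∉ A → g z = 0)}
        rw [hg, mul_zero] at this
        exact this
      rw [mem_vanishingOutside]
      filter_upwards [hgE, hgh] with z hz hz' hzA
      rw [← hz']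
      exact hz hzA
  rw [Lp.eq_zero_iff_ae_eq_zero]
  have hz : ∀ᵐ z, g (E z) = 0 := by
    rw [hh] at hgh
    filter_upwards [hgh, Lp.coeFn_zero ℂ 2 (volume : Measure (Fin n → ℂ))] with z h1 h2
    rw [h1, h2, Pi.zero_apply]
  -- Since `c ≠ 0`, a set with null preimage under `E` is null, so vanishing of `g ∘ E` passes back
  -- to `g`.
  have := hpre {z | ¬ g z = 0}
  rw [show volume (E ⁻¹' {z | ¬ g z = 0}) = 0 from ae_iff.1 hz] at this
  exact ae_iff.2 ((mul_eq_zero.1 this.symm).resolve_left hc0)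

end HeisenbergWeyl

open HeisenbergWeyl in
theorem proposition6p7 (n : ℕ) (hn : 1 ≤ n) (A : Set (Fin n → ℂ))
    (hA : NullMeasurableSet A (volume : Measure (Fin n → ℂ)))
    (hA_fin : (volume : Measure (Fin n → ℂ)) A < ⊤) :
    (∀ lam : ℝ, lam ≠ 0 → ∀ g : L1C n, (∀ᵐ z : Fin n → ℂ, z ∉ A → g z = 0) →
      FiniteDimensional ℂ (weylTransform lam g).range → g = 0) ∧
    (∀ (B : Submodule ℂ (L2R n)) [FiniteDimensional ℂ B],
      projInter (projE A hA) (projF B) = 0) := by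
  exact ⟨fun lam hlam g hg hB =>
    eq_zero_of_finiteDimensional_range_weylTransform hn hA_fin.ne hlam hg hB,
    fun B _ => projInter_projE_projF hn hA hA_fin.ne B⟩
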